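/- Let $\delta$ be a cardinal. A \emph{normal fine measure} on $\mathcal P_\delta(\gamma)=\{\sigma\subseteq\gamma : |\sigma|<\delta\}$ is a $\delta$-complete ultrafilter $\mathcal U$ on $\mathcal P_\delta(\gamma)$ that is fine ($\{\sigma\in\mathcal P_\delta(\gamma) : \alpha\in\sigma\}\in\mathcal U$ for every $\alpha<\gamma$) and normal (whenever $X\in\mathcal U$ and $f$ is a function on $X$ with $f(\sigma)\in\sigma$ for all $\sigma\in X$, there are $Y\in\mathcal U$ with $Y\subseteq X$ and $\alpha<\gamma$ such that $f(\sigma)=\alpha$ for all $\sigma\in Y$). A transitive class $N$ that is a model of ZFC is a \emph{weak extender model for $\delta$ supercompact} if for every ordinal $\gamma>\delta$ there is a normal fine measure $\mathcal U$ on $\mathcal P_\delta(\gamma)$ such that $N\cap\mathcal P_\delta(\gamma)\in\mathcal U$ and $\mathcal U\cap N\in N$. Let $N$ be a weak extender model for $\delta$ supercompact. (a) If $\gamma>\delta$ is an ordinal such that $N\models$ ``$\gamma$ is a regular cardinal'', then $|\gamma|=\mathrm{cf}(\gamma)$, where cardinality and cofinality are computed in $V$. (b) If $\gamma>\delta$ is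 a singular cardinal (in $V$), then $N\models$ ``$\gamma$ is a singular cardinal'' and $(\gamma^+)^N=\gamma^+$. -/

import Mathlib

universe u

open FirstOrder

namespace WeakExtender

/-! ### First-order set theory in a structure `(M, E)` -/

/-- The symbols of the language of set theory: a single binary relation symbol. -/
inductive MemSymbol : ℕ → Type
  | mem : MemSymbol 2

/-- The first-order language of set theory. -/
def setLanguage : Language := ⟨fun _ => Empty, MemSymbol⟩

/-- The structure `(M, E)` for the language of set theory. -/
@[reducible] def memStructure {M : Type*} (E : M → M → Prop) : setLanguage.Structure M where
  funMap := fun f => f.elim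
  RelMap := fun r => match r with
    | .mem => fun v => E (v 0) (v 1)

/-- `S` is first-order definable over `(M, E)`, with parameters from `M`. -/
def DefinableClass {M : Type*} (E : M → M → Prop) (S : Set M) : Prop :=
  @Set.Definable₁ M Set.univ setLanguage (memStructure E) S

/-- The binary relation `R` is first-order definable over `(M, E)`, with parameters from `M`. -/
def DefinableRelation {M : Type*} (E : M → M → Prop) (R : Set (M × M)) : Prop :=
  @Set.Definable₂ M Set.univ setLanguage (memStructure E) R

/-- `(M, E)` satisfies the first-order axioms of ZFC. -/
structure ModelsZFC {M : Type*} (E : M → M → Prop) : Prop where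
  extensionality : ∀ x y, (∀ z, E z x ↔ E z y) → x = y
  foundation : ∀ x, (∃ y, E y x) → ∃ y, E y x ∧ ∀ z, E z x → ¬ E z y
  pairing : ∀ x y, ∃ p, ∀ z, E z p ↔ z = x ∨ z = y
  union : ∀ a, ∃ b, ∀ z, E z b ↔ ∃ y, E y a ∧ E z y
  powerset : ∀ a, ∃ b, ∀ x, E x b ↔ ∀ z, E z x → E z a
  infinity : ∃ a, (∃ x, E x a ∧ ∀ z, ¬ E z x) ∧
    ∀ x, E x a → ∃ s, E s a ∧ ∀ z, E z s ↔ E z x ∨ z = x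
  separation : ∀ S : Set M, DefinableClass E S → ∀ a, ∃ b, ∀ x, E x b ↔ E x a ∧ x ∈ S
  replacement : ∀ R : Set (M × M), DefinableRelation E R → ∀ a,
    (∀ x, E x a → ∃! y, (x, y) ∈ R) → ∃ b, ∀ y, E y b ↔ ∃ x, E x a ∧ (x, y) ∈ R
  /-- A family of pairwise disjoint nonempty sets has a transversal. -/
  choice : ∀ a, (∀ x, E x a → ∃ z, E z x) →
    (∀ x y z, E x a → E y a → E z x → E z y → x = y) →
    ∃ c, ∀ x, E x a → ∃! z, E z c ∧ E z x

/-- `(M, E) ⊨ p = {x, y}`. -/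
def IsUnorderedPair {M : Type*} (E : M → M → Prop) (p x y : M) : Prop :=
  ∀ z, E z p ↔ z = x ∨ z = y

/-- `(M, E) ⊨ p = (x, y)`, with Kuratowski's ordered pair `{{x}, {x, y}}`. -/
def IsOrderedPair {M : Type*} (E : M → M → Prop) (p x y : M) : Prop :=
  ∃ s t, IsUnorderedPair E s x x ∧ IsUnorderedPair E t x y ∧ IsUnorderedPair E p s t

/-- `(M, E) ⊨ (x, y) ∈ f`. -/
def MapsTo {M : Type*} (E : M → M → Prop) (f x y : M) : Prop :=
  ∃ p, E p f ∧ IsOrderedPair E p x y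

/-- `(M, E) ⊨ f is a function from a to b`. -/
def IsFunction {M : Type*} (E : M → M → Prop) (f a b : M) : Prop :=
  (∀ p, E p f → ∃ x y, E x a ∧ E y b ∧ IsOrderedPair E p x y) ∧
    ∀ x, E x a → ∃! y, MapsTo E f x y

/-- `(M, E) ⊨ a is transitive`. -/
def IsTransitiveIn {M : Type*} (E : M → M → Prop) (a : M) : Prop :=
  ∀ x, E x a → ∀ z, E z x → E z a

/-- `(M, E) ⊨ a is an ordinal`, that is, a transitive set of transitive sets. -/
def IsOrdinalIn {M : Type*} (E : M → M → Prop) (a : M) : Prop :=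
  IsTransitiveIn E a ∧ ∀ x, E x a → IsTransitiveIn E x

/-- `(M, E) ⊨ k is a cardinal`: an ordinal onto which no smaller ordinal can be mapped. -/
def IsCardinalIn {M : Type*} (E : M → M → Prop) (k : M) : Prop :=
  IsOrdinalIn E k ∧
    ∀ a, E a k → ¬ ∃ f, IsFunction E f a k ∧ ∀ y, E y k → ∃ x, E x a ∧ MapsTo E f x y

/-- `(M, E) ⊨ k is an infinite cardinal`: a cardinal that is nonempty and has no largest
element. -/
def IsInfiniteCardinalIn {M : Type*} (E : M → M → Prop) (k : M) : Prop :=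
  IsCardinalIn E k ∧ (∃ x, E x k) ∧ ∀ x, E x k → ∃ y, E y k ∧ E x y

/-- `(M, E) ⊨ f is a function from a to k with range cofinal in k`, for ordinals `a` and `k`. -/
def IsCofinalMap {M : Type*} (E : M → M → Prop) (f a k : M) : Prop :=
  IsFunction E f a k ∧
    ∀ b, E b k → ∃ x y, E x a ∧ MapsTo E f x y ∧ (b = y ∨ E b y)

/-- `(M, E) ⊨ k is a regular cardinal`. -/
def IsRegularIn {M : Type*} (E : M → M → Prop) (k : M) : Prop :=
  IsInfiniteCardinalIn E k ∧ ∀ a, E a k → ¬ ∃ f, IsCofinalMap E f a k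

/-- `(M, E) ⊨ k is a singular cardinal`. -/
def IsSingularIn {M : Type*} (E : M → M → Prop) (k : M) : Prop :=
  IsInfiniteCardinalIn E k ∧ ∃ a, E a k ∧ ∃ f, IsCofinalMap E f a k

/-- `(M, E) ⊨ s = k⁺`: `s` is the least cardinal above `k`. -/
def IsSuccCardinalIn {M : Type*} (E : M → M → Prop) (s k : M) : Prop :=
  IsCardinalIn E s ∧ E k s ∧ ∀ t, IsCardinalIn E t → E k t → s = t ∨ E s t

/-! ### Classes of sets, the universe `V` being `ZFSet` -/

/-- The membership relation restricted to the class `N`. -/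
def memOn (N : Set ZFSet.{u}) (x y : N) : Prop := (x : ZFSet.{u}) ∈ (y : ZFSet.{u})

/-- `𝒫_δ(γ)`, the set of all subsets of `γ` of cardinality less than `δ`. -/
noncomputable def Pset (δ : Cardinal.{u}) (γ : Ordinal.{u}) : ZFSet.{u} :=
  ZFSet.sep (fun σ => σ.card < δ) (ZFSet.powerset γ.toZFSet)

/-- `U` is a normal fine measure on `𝒫_δ(γ)`: a `δ`-complete ultrafilter on the set `𝒫_δ(γ)` that
is fine and normal. -/
structure IsNormalFineMeasure (δ : Cardinal.{u}) (γ : Ordinal.{u}) (U : ZFSet.{u}) : Prop where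
  subset : ∀ X ∈ U, X ⊆ Pset δ γ
  univ_mem : Pset δ γ ∈ U
  empty_notMem : ∅ ∉ U
  mem_of_superset : ∀ X ∈ U, ∀ Y, X ⊆ Y → Y ⊆ Pset δ γ → Y ∈ U
  inter_mem : ∀ X ∈ U, ∀ Y ∈ U, X ∩ Y ∈ U
  mem_or_compl_mem : ∀ X, X ⊆ Pset δ γ → X ∈ U ∨ Pset δ γ \ X ∈ U
  complete : ∀ A : ZFSet.{u}, A ⊆ U → A.Nonempty → A.card < δ → ZFSet.sInter A ∈ U
  fine : ∀ α ∈ γ.toZFSet, ZFSet.sep (fun σ => α ∈ σ) (Pset δ γ) ∈ U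
  normal : ∀ X ∈ U, ∀ f : ZFSet.{u} → ZFSet.{u}, (∀ σ ∈ X, f σ ∈ σ) →
    ∃ Y ∈ U, Y ⊆ X ∧ ∃ α ∈ γ.toZFSet, ∀ σ ∈ Y, f σ = α

/-- The transitive class `N`, a model of ZFC, is a weak extender model for `δ` supercompact. -/
structure IsWeakExtenderModel (N : Set ZFSet.{u}) (δ : Cardinal.{u}) : Prop where
  transitive : ∀ x ∈ N, ∀ y ∈ x, y ∈ N
  zfc : ModelsZFC (memOn N)
  measures : ∀ γ : Ordinal.{u}, δ.ord < γ → ∃ U : ZFSet.{u}, IsNormalFineMeasure δ γ U ∧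
    ZFSet.sep (fun σ => σ ∈ N) (Pset δ γ) ∈ U ∧ ZFSet.sep (fun X => X ∈ N) U ∈ N

/-- `N ⊨ γ is a regular cardinal`, for an ordinal `γ`. -/
def RegularInClass (N : Set ZFSet.{u}) (γ : Ordinal.{u}) : Prop :=
  ∃ h : γ.toZFSet ∈ N, IsRegularIn (memOn N) ⟨γ.toZFSet, h⟩

/-- `N ⊨ γ is a singular cardinal`, for an ordinal `γ`. -/
def SingularInClass (N : Set ZFSet.{u}) (γ : Ordinal.{u}) : Prop :=
  ∃ h : γ.toZFSet ∈ N, IsSingularIn (memOn N) ⟨γ.toZFSet, h⟩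

/-- `(γ⁺)^N = ν`, for ordinals `γ` and `ν`. -/
def SuccInClass (N : Set ZFSet.{u}) (γ ν : Ordinal.{u}) : Prop :=
  ∃ (hγ : γ.toZFSet ∈ N) (hν : ν.toZFSet ∈ N),
    IsSuccCardinalIn (memOn N) ⟨ν.toZFSet, hν⟩ ⟨γ.toZFSet, hγ⟩

end WeakExtender

/-!
# Regular and singular cardinals of a weak extender model

Let `N` be a weak extender model for `δ` supercompact.

*Ordinals that are regular in `N`.* Let `γ > δ` be regular in `N`, and let `U` be a normal fine
measure on `𝒫_δ(γ)` that concentrates on `N` and satisfies `U ∩ N ∈ N`. Almost every `σ` belongs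
to `N` and is bounded in `γ`, whereas a cofinal subset of `γ` with fewer than `δ` elements would
be included in almost every `σ`; so `δ ≤ cf γ` (`le_cof_of_regularInClass`). By choice, `N`
contains a family `c` of elements of `𝒫_δ(γ)` without largest elements, one for each possible
supremum (`exists_representatives`). Call the member of `c` with supremum `sup σ` the
representative of `σ`. By normality, for every `ξ < γ` there is `η < γ` such that almost every
representative meets `[ξ, η)`. Since `U ∩ N ∈ N`, the set of closure points of `ξ ↦ η` belongs to
`N`, and it is unbounded as `cf γ > ω` (`exists_unbounded_meetsInterval`); call it `E`. It has
cardinality `|γ|`, since its increasing enumeration is in `N`, where `γ` is regular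
(`card_le_card_of_unbounded`). Now let `D` be cofinal in `γ` with `|D| = cf γ`. By normality and
fineness, the supremum of almost every `σ` is a limit point of `D`, so that every interval between
consecutive elements of `E` meets one of the at most `|D|` members of `c` whose suprema are limit
points of `D`. As these have size less than `δ ≤ cf γ`, this gives `|γ| = |E| ≤ cf γ`
(`card_eq_cof_of_regularInClass`). The representatives replace Solovay's sets on which the
supremum is one-to-one, which avoids stationary sets.

*Singular cardinals.* A singular cardinal `γ > δ` of `V` is a cardinal of `N`, and it is singular
there by the first part. If `γ⁺` were not the successor of `γ` in `N`, then the successor `t < γ⁺`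
of `γ` in `N` would be regular in `N` (`regularInClass_of_succ`), and the first part would give
`γ = |t| = cf t`, which is regular.

*Working inside `N`.* Separation in `N` applies to predicates that are definable over `(N, ∈)`.
The classes `IsDefPred` and `IsDefTerm` let instance resolution establish definability from the
syntactic form of a predicate in which all quantifiers are bounded by sets or by `N`. Enumerations
of sets of ordinals and a pairing function on `γ` come from one recursion principle: `N` contains
the rank function of every definable well-founded relation on an element of `N`
(`exists_rank_graph`).
-/

namespace WeakExtender

/-! ### Definable predicates over a transitive class -/

/-- `P` is definable with parameters over `(N, ∈)`; the free variables are indexed by `ι`. Under a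
quantifier the index type grows to `ι ⊕ Unit`. -/
class IsDefPred (N : Set ZFSet.{u}) {ι : Type} (P : (ι → N) → Prop) : Prop where
  out : @Set.Definable N Set.univ setLanguage (memStructure (memOn N)) ι {v | P v}

/-- `t` takes values in `N` and its graph is definable with parameters over `(N, ∈)`. -/
class IsDefTerm (N : Set ZFSet.{u}) {ι : Type} (t : (ι → N) → ZFSet.{u}) : Prop where
  mem : ∀ v, t v ∈ N
  graph : IsDefPred N (fun w : ι ⊕ Unit → N => t (fun i => w (.inl i)) = w (.inr ()))

/-- `N` is a transitive class that satisfies ZFC and contains all ordinals. -/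
class IsInnerModel (N : Set ZFSet.{u}) : Prop where
  transitive : ∀ x ∈ N, ∀ y ∈ x, y ∈ N
  zfc : ModelsZFC (memOn N)
  ordinal_mem : ∀ α : Ordinal.{u}, α.toZFSet ∈ N

section Definability

variable {N : Set ZFSet.{u}} {ι : Type}

instance IsDefPred.and {P Q : (ι → N) → Prop} [hP : IsDefPred N P] [hQ : IsDefPred N Q] :
    IsDefPred N (fun v => P v ∧ Q v) :=
  let _ := memStructure (memOn N)
  ⟨hP.out.inter hQ.out⟩

instance IsDefPred.or {P Q : (ι → N) → Prop} [hP : IsDefPred N P] [hQ : IsDefPred N Q] :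
    IsDefPred N (fun v => P v ∨ Q v) :=
  let _ := memStructure (memOn N)
  ⟨hP.out.union hQ.out⟩

instance IsDefPred.not {P : (ι → N) → Prop} [hP : IsDefPred N P] :
    IsDefPred N (fun v => ¬ P v) :=
  let _ := memStructure (memOn N)
  ⟨hP.out.compl⟩

instance IsDefPred.imp {P Q : (ι → N) → Prop} [IsDefPred N P] [IsDefPred N Q] :
    IsDefPred N (fun v => P v → Q v) := by
  have : IsDefPred N (fun v => ¬ P v ∨ Q v) := inferInstance
  simpa only [← imp_iff_not_or] using this

instance IsDefPred.iff {P Q : (ι → N) → Prop} [IsDefPred N P] [IsDefPred N Q] :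
    IsDefPred N (fun v => P v ↔ Q v) := by
  have : IsDefPred N (fun v => (P v → Q v) ∧ (Q v → P v)) := inferInstance
  simpa only [← iff_iff_implies_and_implies] using this

theorem IsDefPred.exists_subtype {P : (ι → N) → N → Prop}
    (h : IsDefPred N (fun w : ι ⊕ Unit → N => P (fun i => w (.inl i)) (w (.inr ())))) :
    IsDefPred N (fun v => ∃ x : N, P v x) := by
  let _ := memStructure (memOn N)
  refine ⟨?_⟩
  have := h.out.exists_of_finite
  convert this using 2
  ext v
  constructor
  · rintro ⟨x, hx⟩
    exact ⟨fun _ => x, hx⟩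
  · rintro ⟨x, hx⟩
    exact ⟨x (), hx⟩

instance IsDefPred.exists_mem_class {P : (ι → N) → ZFSet.{u} → Prop}
    [h : IsDefPred N (fun w : ι ⊕ Unit → N => P (fun i => w (.inl i)) (w (.inr ())))] :
    IsDefPred N (fun v => ∃ x ∈ N, P v x) := by
  have := IsDefPred.exists_subtype (P := fun v x => P v x) h
  simpa using this

theorem IsDefPred.comp {κ : Type} {P : (ι → N) → Prop} (h : IsDefPred N P) (f : ι → κ) :
    IsDefPred N (fun w : κ → N => P (fun i => w (f i))) :=
  let _ := memStructure (memOn N)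
  ⟨h.out.preimage_comp f⟩

theorem isDefPred_mem (i j : ι) : IsDefPred N (fun v => (v i : ZFSet.{u}) ∈ (v j : ZFSet.{u})) := by
  let _ := memStructure (memOn N)
  let r : setLanguage.Relations 2 := MemSymbol.mem
  refine ⟨(setLanguage.lhomWithConstants Set.univ).onFormula
    (r.formula₂ (Language.Term.var i) (Language.Term.var j)), ?_⟩
  ext v
  simp [r]
  rfl

theorem isDefPred_eq (i j : ι) : IsDefPred N (fun v => v i = v j) := by
  let _ := memStructure (memOn N)
  refine ⟨(Language.Term.var i).equal (Language.Term.var j), ?_⟩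
  ext v
  simp

theorem isDefPred_eq_const (i : ι) (c : N) : IsDefPred N (fun v => v i = c) := by
  let _ := memStructure (memOn N)
  refine ⟨(Language.Term.var i).equal
    (setLanguage.con (⟨c, trivial⟩ : (Set.univ : Set N))).term, ?_⟩
  ext v
  simp

theorem isDefTerm_of_graph {t : (ι → N) → N}
    (h : IsDefPred N (fun w : ι ⊕ Unit → N => t (fun i => w (.inl i)) = w (.inr ()))) :
    IsDefTerm N (fun v => (t v : ZFSet.{u})) :=
  ⟨fun v => (t v).2, by simpa [Subtype.ext_iff] using h⟩

instance IsDefTerm.var (i : ι) : IsDefTerm N (fun v => (v i : ZFSet.{u})) :=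
  isDefTerm_of_graph (isDefPred_eq _ _)

instance IsDefTerm.const (c : ZFSet.{u}) [hc : Fact (c ∈ N)] :
    IsDefTerm N (fun _ : ι → N => c) :=
  isDefTerm_of_graph (t := fun _ => ⟨c, hc.out⟩) (by
    simpa only [eq_comm] using isDefPred_eq_const (ι := ι ⊕ Unit) (.inr ()) ⟨c, hc.out⟩)

/-- A definable function may be substituted for a variable. -/
theorem IsDefPred.subst {P : (ι → N) → ZFSet.{u} → Prop} {t : (ι → N) → ZFSet.{u}}
    [ht : IsDefTerm N t]
    (h : IsDefPred N (fun w : ι ⊕ Unit → N => P (fun i => w (.inl i)) (w (.inr ())))) :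
    IsDefPred N (fun v => P v (t v)) := by
  have := ht.graph
  have h2 : IsDefPred N (fun v => ∃ x : N, t v = x ∧ P v x) :=
    IsDefPred.exists_subtype (P := fun v x => t v = x ∧ P v x) inferInstance
  convert h2 using 2 with v
  exact ⟨fun hp => ⟨⟨t v, ht.mem v⟩, rfl, hp⟩, by rintro ⟨x, hx, hp⟩; rwa [hx]⟩

theorem IsDefTerm.comp {κ : Type} {t : (ι → N) → ZFSet.{u}} (h : IsDefTerm N t) (f : ι → κ) :
    IsDefTerm N (fun w : κ → N => t (fun i => w (f i))) :=
  ⟨fun _ => h.mem _, h.graph.comp (κ := κ ⊕ Unit) (Sum.map f id)⟩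

/-- A binary relation that is definable on the elements of `N`. -/
class IsDefRel (N : Set ZFSet.{u}) (R : ZFSet.{u} → ZFSet.{u} → Prop) : Prop where
  out : IsDefPred N (fun v : Fin 2 → N => R (v 0) (v 1))

theorem IsDefPred.rel {R : ZFSet.{u} → ZFSet.{u} → Prop} [hR : IsDefRel N R]
    {s t : (ι → N) → ZFSet.{u}} [hs : IsDefTerm N s] [ht : IsDefTerm N t] :
    IsDefPred N (fun v => R (s v) (t v)) := by
  refine IsDefPred.subst (P := fun v x => R x (t v)) ?_
  have := ht.comp (κ := ι ⊕ Unit) Sum.inl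
  refine IsDefPred.subst (ι := ι ⊕ Unit) (P := fun w x => R (w (.inr ())) x)
    (t := fun w => t (fun i => w (.inl i))) ?_
  exact hR.out.comp (κ := (ι ⊕ Unit) ⊕ Unit) ![.inl (.inr ()), .inr ()]

theorem IsDefPred.rel₃ {R : ZFSet.{u} → ZFSet.{u} → ZFSet.{u} → Prop}
    (hR : IsDefPred N (fun v : Fin 3 → N => R (v 0) (v 1) (v 2)))
    {r s t : (ι → N) → ZFSet.{u}} [hr : IsDefTerm N r] [hs : IsDefTerm N s] [ht : IsDefTerm N t] :
    IsDefPred N (fun v => R (r v) (s v) (t v)) := by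
  refine IsDefPred.subst (P := fun v x => R x (s v) (t v)) ?_
  have := hs.comp (κ := ι ⊕ Unit) Sum.inl
  have : IsDefTerm N (fun w : (ι ⊕ Unit) ⊕ Unit → N => t (fun i => w (.inl (.inl i)))) :=
    ht.comp (Sum.inl ∘ Sum.inl)
  refine IsDefPred.subst (ι := ι ⊕ Unit)
    (P := fun w x => R (w (.inr ())) x (t fun i => w (.inl i)))
    (t := fun w => s (fun i => w (.inl i))) ?_
  refine IsDefPred.subst (ι := (ι ⊕ Unit) ⊕ Unit)
    (P := fun w x => R (w (.inl (.inr ()))) (w (.inr ())) x)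
    (t := fun w => t (fun i => w (.inl (.inl i)))) ?_
  exact hR.comp (κ := ((ι ⊕ Unit) ⊕ Unit) ⊕ Unit)
    ![.inl (.inl (.inr ())), .inl (.inr ()), .inr ()]

instance IsDefPred.mem {s t : (ι → N) → ZFSet.{u}} [IsDefTerm N s] [IsDefTerm N t] :
    IsDefPred N (fun v => s v ∈ t v) :=
  have : IsDefRel N (fun x y => x ∈ y) := ⟨isDefPred_mem 0 1⟩
  IsDefPred.rel (R := fun x y => x ∈ y)

instance IsDefPred.eq {s t : (ι → N) → ZFSet.{u}} [IsDefTerm N s] [IsDefTerm N t] :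
    IsDefPred N (fun v => s v = t v) :=
  have : IsDefRel N (fun x y => x = y) := ⟨by simpa [Subtype.ext_iff] using isDefPred_eq 0 1⟩
  IsDefPred.rel (R := fun x y => x = y)

variable [hN : IsInnerModel N]

instance IsDefPred.exists_mem {P : (ι → N) → ZFSet.{u} → Prop} {t : (ι → N) → ZFSet.{u}}
    [ht : IsDefTerm N t]
    [h : IsDefPred N (fun w : ι ⊕ Unit → N => P (fun i => w (.inl i)) (w (.inr ())))] :
    IsDefPred N (fun v => ∃ x ∈ t v, P v x) := by
  have := ht.comp (κ := ι ⊕ Unit) Sum.inl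
  have h2 : IsDefPred N (fun v => ∃ x ∈ N, x ∈ t v ∧ P v x) := inferInstance
  convert h2 using 2 with v
  exact exists_congr fun x =>
    ⟨fun hx => ⟨hN.transitive _ (ht.mem v) _ hx.1, hx⟩, fun hx => hx.2⟩

instance IsDefPred.forall_mem {P : (ι → N) → ZFSet.{u} → Prop} {t : (ι → N) → ZFSet.{u}}
    [ht : IsDefTerm N t]
    [h : IsDefPred N (fun w : ι ⊕ Unit → N => P (fun i => w (.inl i)) (w (.inr ())))] :
    IsDefPred N (fun v => ∀ x ∈ t v, P v x) := by
  have : IsDefPred N (fun v => ¬ ∃ x ∈ t v, ¬ P v x) := inferInstance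
  simpa using this

end Definability

/-! ### Closure properties of inner models -/

section Closure

variable {N : Set ZFSet.{u}} [hN : IsInnerModel N]

theorem sep_mem_class {a : ZFSet.{u}} (ha : a ∈ N) (p : ZFSet.{u} → Prop)
    [hp : IsDefPred N (fun v : Fin 1 → N => p (v 0))] : ZFSet.sep p a ∈ N := by
  obtain ⟨b, hb⟩ := hN.zfc.separation {x : N | p x} hp.out ⟨a, ha⟩
  convert b.2
  ext x
  rw [ZFSet.mem_sep]
  constructor
  · rintro ⟨h1, h2⟩
    exact (hb ⟨x, hN.transitive _ ha _ h1⟩).2 ⟨h1, h2⟩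
  · intro h
    exact (hb ⟨x, hN.transitive _ b.2 _ h⟩).1 h

theorem pair_set_mem_class {x y : ZFSet.{u}} (hx : x ∈ N) (hy : y ∈ N) :
    ({x, y} : ZFSet.{u}) ∈ N := by
  obtain ⟨p, hp⟩ := hN.zfc.pairing ⟨x, hx⟩ ⟨y, hy⟩
  convert p.2
  ext z
  rw [ZFSet.mem_pair]
  constructor
  · rintro (rfl | rfl)
    · exact (hp ⟨_, hx⟩).2 (.inl rfl)
    · exact (hp ⟨_, hy⟩).2 (.inr rfl)
  · intro h
    exact ((hp ⟨z, hN.transitive _ p.2 _ h⟩).1 h).imp (congrArg Subtype.val) (congrArg Subtype.val)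

theorem singleton_mem_class {x : ZFSet.{u}} (hx : x ∈ N) : ({x} : ZFSet.{u}) ∈ N := by
  simpa using pair_set_mem_class hx hx

theorem pair_mem_class {x y : ZFSet.{u}} (hx : x ∈ N) (hy : y ∈ N) : ZFSet.pair x y ∈ N :=
  pair_set_mem_class (singleton_mem_class hx) (pair_set_mem_class hx hy)

theorem sUnion_mem_class {x : ZFSet.{u}} (hx : x ∈ N) : (ZFSet.sUnion x) ∈ N := by
  obtain ⟨p, hp⟩ := hN.zfc.union ⟨x, hx⟩
  convert p.2
  ext z
  rw [ZFSet.mem_sUnion]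
  constructor
  · rintro ⟨y, hy, hz⟩
    have hyN := hN.transitive _ hx _ hy
    exact (hp ⟨z, hN.transitive _ hyN _ hz⟩).2 ⟨⟨y, hyN⟩, hy, hz⟩
  · intro h
    obtain ⟨y, hy, hz⟩ := (hp ⟨z, hN.transitive _ p.2 _ h⟩).1 h
    exact ⟨y, hy, hz⟩

theorem union_mem_class {x y : ZFSet.{u}} (hx : x ∈ N) (hy : y ∈ N) : x ∪ y ∈ N :=
  sUnion_mem_class (pair_set_mem_class hx hy)

theorem insert_mem_class {x y : ZFSet.{u}} (hx : x ∈ N) (hy : y ∈ N) : insert x y ∈ N := by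
  rw [ZFSet.insert_eq]
  exact union_mem_class (singleton_mem_class hx) hy

variable (N) in
/-- The power set of `a` in the sense of `N`. -/
noncomputable def powersetIn (a : ZFSet.{u}) : ZFSet.{u} :=
  ZFSet.sep (· ∈ N) (ZFSet.powerset a)

omit hN in
@[simp]
theorem mem_powersetIn {a x : ZFSet.{u}} : x ∈ powersetIn N a ↔ x ⊆ a ∧ x ∈ N := by
  simp [powersetIn]

theorem powersetIn_mem_class {a : ZFSet.{u}} (ha : a ∈ N) : powersetIn N a ∈ N := by
  obtain ⟨p, hp⟩ := hN.zfc.powerset ⟨a, ha⟩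
  convert p.2
  ext z
  rw [mem_powersetIn]
  constructor
  · rintro ⟨h1, h2⟩
    exact (hp ⟨z, h2⟩).2 fun w hw => h1 hw
  · intro h
    have hz := hN.transitive _ p.2 _ h
    exact ⟨fun w hw => (hp ⟨z, hz⟩).1 h ⟨w, hN.transitive _ hz _ hw⟩ hw, hz⟩

instance IsDefTerm.pair {ι : Type} {s t : (ι → N) → ZFSet.{u}} [hs : IsDefTerm N s]
    [ht : IsDefTerm N t] : IsDefTerm N (fun v => ZFSet.pair (s v) (t v)) := by
  refine ⟨fun v => pair_mem_class (hs.mem v) (ht.mem v), ?_⟩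
  have := hs.comp (κ := ι ⊕ Unit) Sum.inl
  have := ht.comp (κ := ι ⊕ Unit) Sum.inl
  have key : ∀ p x y : ZFSet.{u}, ZFSet.pair x y = p ↔
      (∃ a ∈ p, (∀ z ∈ a, z = x) ∧ x ∈ a) ∧
      (∃ b ∈ p, (∀ z ∈ b, z = x ∨ z = y) ∧ x ∈ b ∧ y ∈ b) ∧
      (∀ c ∈ p, ((∀ z ∈ c, z = x) ∧ x ∈ c) ∨ ((∀ z ∈ c, z = x ∨ z = y) ∧ x ∈ c ∧ y ∈ c)) := by
    intro p x y
    have h1 : ∀ a : ZFSet.{u}, ((∀ z ∈ a, z = x) ∧ x ∈ a) ↔ a = {x} := by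
      intro a
      constructor
      · rintro ⟨h, hx⟩
        ext z
        rw [ZFSet.mem_singleton]
        exact ⟨h z, fun e => e ▸ hx⟩
      · rintro rfl
        simp
    have h2 : ∀ a : ZFSet.{u}, ((∀ z ∈ a, z = x ∨ z = y) ∧ x ∈ a ∧ y ∈ a) ↔ a = {x, y} := by
      intro a
      constructor
      · rintro ⟨h, hx, hy⟩
        ext z
        rw [ZFSet.mem_pair]
        exact ⟨h z, fun e => e.elim (fun e => e ▸ hx) (fun e => e ▸ hy)⟩
      · rintro rfl
        simp
    simp only [h1, h2, exists_eq_right]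
    constructor
    · rintro rfl
      simp [ZFSet.pair]
    · rintro ⟨h3, h4, h5⟩
      ext z
      rw [ZFSet.pair, ZFSet.mem_pair]
      exact ⟨fun e => e.elim (fun e => e ▸ h3) (fun e => e ▸ h4), h5 z⟩
  refine IsDefPred.rel₃ (R := fun p x y => ZFSet.pair x y = p) ?_
    (r := fun w : ι ⊕ Unit → N => (w (.inr ()) : ZFSet.{u}))
  simp only [key]
  infer_instance

theorem prod_mem_class {a b : ZFSet.{u}} (ha : a ∈ N) (hb : b ∈ N) : ZFSet.prod a b ∈ N := by
  have : Fact (a ∈ N) := ⟨ha⟩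
  have : Fact (b ∈ N) := ⟨hb⟩
  have h := sep_mem_class
    (powersetIn_mem_class (powersetIn_mem_class (union_mem_class ha hb)))
    (fun p => ∃ x ∈ a, ∃ y ∈ b, p = ZFSet.pair x y)
  convert h
  ext p
  rw [ZFSet.mem_prod, ZFSet.mem_sep]
  refine ⟨?_, fun h => h.2⟩
  rintro ⟨x, hx, y, hy, rfl⟩
  have hxN := hN.transitive _ ha _ hx
  have hyN := hN.transitive _ hb _ hy
  refine ⟨?_, x, hx, y, hy, rfl⟩
  rw [mem_powersetIn]
  refine ⟨fun z hz => ?_, pair_mem_class hxN hyN⟩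
  rw [mem_powersetIn]
  rw [ZFSet.pair, ZFSet.mem_pair] at hz
  rcases hz with rfl | rfl
  · refine ⟨fun w hw => ?_, singleton_mem_class hxN⟩
    rw [ZFSet.mem_singleton] at hw
    simp [hw, hx]
  · refine ⟨fun w hw => ?_, pair_set_mem_class hxN hyN⟩
    rw [ZFSet.mem_pair] at hw
    rcases hw with rfl | rfl <;> simp [hx, hy]

/-- A definable binary relation between elements of `a` and elements of `b` is given by an element
of the inner model. -/
theorem exists_graph_mem_class {a b : ZFSet.{u}} (ha : a ∈ N) (hb : b ∈ N)
    (R : ZFSet.{u} → ZFSet.{u} → Prop)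
    [hR : IsDefPred N (fun v : Fin 2 → N => R (v 0) (v 1))] :
    ∃ F ∈ N, (∀ p ∈ F, ∃ x ∈ a, ∃ y ∈ b, p = ZFSet.pair x y) ∧
      ∀ x y, ZFSet.pair x y ∈ F ↔ x ∈ a ∧ y ∈ b ∧ R x y := by
  have : Fact (a ∈ N) := ⟨ha⟩
  have : Fact (b ∈ N) := ⟨hb⟩
  have hR' : ∀ {κ : Type} {s t : (κ → N) → ZFSet.{u}} [IsDefTerm N s] [IsDefTerm N t],
      IsDefPred N (fun v => R (s v) (t v)) :=
    have : IsDefRel N R := ⟨hR⟩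
    IsDefPred.rel
  refine ⟨_, sep_mem_class (prod_mem_class ha hb)
    (fun p => ∃ x ∈ a, ∃ y ∈ b, p = ZFSet.pair x y ∧ R x y), ?_, ?_⟩
  · intro p hp
    obtain ⟨x, hx, y, hy, h, -⟩ := (ZFSet.mem_sep.1 hp).2
    exact ⟨x, hx, y, hy, h⟩
  · intro x y
    rw [ZFSet.mem_sep, ZFSet.pair_mem_prod]
    constructor
    · rintro ⟨-, x', hx, y', hy, h, hR⟩
      obtain ⟨rfl, rfl⟩ := ZFSet.pair_inj.1 h
      exact ⟨hx, hy, hR⟩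
    · rintro ⟨hx, hy, h⟩
      exact ⟨⟨hx, hy⟩, x, hx, y, hy, rfl, h⟩

/-! ### Absoluteness of basic notions -/

theorem isUnorderedPair_iff {p x y : N} :
    IsUnorderedPair (memOn N) p x y ↔ (p : ZFSet.{u}) = {(x : ZFSet.{u}), (y : ZFSet.{u})} := by
  constructor
  · intro h
    ext z
    rw [ZFSet.mem_pair]
    constructor
    · intro hz
      exact ((h ⟨z, hN.transitive _ p.2 _ hz⟩).1 hz).imp (congrArg Subtype.val)
        (congrArg Subtype.val)
    · rintro (rfl | rfl)
      · exact (h x).2 (.inl rfl)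
      · exact (h y).2 (.inr rfl)
  · intro h z
    rw [memOn, h, ZFSet.mem_pair, Subtype.ext_iff, Subtype.ext_iff]

theorem isOrderedPair_iff {p x y : N} :
    IsOrderedPair (memOn N) p x y ↔ (p : ZFSet.{u}) = ZFSet.pair x y := by
  simp only [IsOrderedPair, isUnorderedPair_iff]
  constructor
  · rintro ⟨s, t, hs, ht, hp⟩
    rw [hp, hs, ht, ZFSet.pair, ZFSet.pair_eq_singleton]
  · intro h
    exact ⟨⟨_, pair_set_mem_class x.2 x.2⟩, ⟨_, pair_set_mem_class x.2 y.2⟩, rfl, rfl, by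
      simp [h, ZFSet.pair]⟩

theorem mapsTo_iff {f x y : N} :
    MapsTo (memOn N) f x y ↔ ZFSet.pair x y ∈ (f : ZFSet.{u}) := by
  simp only [MapsTo, isOrderedPair_iff]
  constructor
  · rintro ⟨p, hp, h⟩
    exact h ▸ hp
  · intro h
    exact ⟨⟨_, pair_mem_class x.2 y.2⟩, h, rfl⟩

theorem isTransitiveIn_iff {a : N} :
    IsTransitiveIn (memOn N) a ↔ (a : ZFSet.{u}).IsTransitive := by
  constructor
  · intro h x hx z hz
    have hxN := hN.transitive _ a.2 _ hx
    exact h ⟨x, hxN⟩ hx ⟨z, hN.transitive _ hxN _ hz⟩ hz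
  · intro h x hx z hz
    exact h x hx hz

theorem isOrdinalIn_iff {a : N} :
    IsOrdinalIn (memOn N) a ↔ (a : ZFSet.{u}).IsOrdinal := by
  rw [ZFSet.isOrdinal_iff_forall_mem_isTransitive]
  simp only [IsOrdinalIn, isTransitiveIn_iff]
  refine and_congr_right fun _ => ⟨fun h y hy => ?_, fun h x hx => h x hx⟩
  exact h ⟨y, hN.transitive _ a.2 _ hy⟩ hy

/-- A single-valued relation in `N` that covers a cardinal of `N` does not live on a smaller
ordinal: it extends to a total function by sending the remaining points to `0`. -/
theorem not_covered_of_isCardinalIn {κ α : Ordinal.{u}} {h : κ.toZFSet ∈ N}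
    (hκ : IsCardinalIn (memOn N) ⟨κ.toZFSet, h⟩) (hα : α < κ)
    (R : ZFSet.{u} → ZFSet.{u} → Prop) [hR : IsDefPred N (fun v : Fin 2 → N => R (v 0) (v 1))]
    (hfun : ∀ x ∈ α.toZFSet, ∀ y ∈ κ.toZFSet, ∀ z ∈ κ.toZFSet, R x y → R x z → y = z) :
    ∃ β < κ, ∀ x ∈ α.toZFSet, ¬ R x β.toZFSet := by
  by_contra! hcon
  have : ∀ β : Ordinal.{u}, Fact (β.toZFSet ∈ N) := fun β => ⟨hN.ordinal_mem β⟩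
  have hR' : ∀ {κ : Type} {s t : (κ → N) → ZFSet.{u}} [IsDefTerm N s] [IsDefTerm N t],
      IsDefPred N (fun v => R (s v) (t v)) :=
    have : IsDefRel N R := ⟨hR⟩
    IsDefPred.rel
  obtain ⟨F, hF, hFp, hFm⟩ := exists_graph_mem_class (hN.ordinal_mem α) h
    (fun x y => R x y ∨ (y = (0 : Ordinal.{u}).toZFSet ∧ ∀ z ∈ κ.toZFSet, ¬ R x z))
  have h0 : (0 : Ordinal.{u}).toZFSet ∈ κ.toZFSet := by
    exact Ordinal.toZFSet_mem_toZFSet_iff.2 (bot_le.trans_lt hα)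
  refine hκ.2 ⟨α.toZFSet, hN.ordinal_mem α⟩ (by simpa [memOn] using hα) ⟨⟨F, hF⟩, ⟨?_, ?_⟩, ?_⟩
  · rintro ⟨p, hp⟩ hpF
    obtain ⟨x, hx, y, hy, rfl⟩ := hFp p hpF
    exact ⟨⟨x, hN.transitive _ (hN.ordinal_mem α) _ hx⟩, ⟨y, hN.transitive _ h _ hy⟩, hx, hy,
      isOrderedPair_iff.2 rfl⟩
  · rintro ⟨x, hxN⟩ hx
    change x ∈ α.toZFSet at hx
    simp only [mapsTo_iff, hFm]
    by_cases hz : ∃ z ∈ κ.toZFSet, R x z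
    · obtain ⟨z, hz, hxz⟩ := hz
      refine ⟨⟨z, hN.transitive _ h _ hz⟩, ⟨hx, hz, .inl hxz⟩, ?_⟩
      rintro ⟨y, hy⟩ ⟨-, hyk, h1 | h1⟩
      · exact Subtype.ext (hfun _ hx _ hyk _ hz h1 hxz)
      · exact (h1.2 z hz hxz).elim
    · push Not at hz
      refine ⟨⟨_, hN.ordinal_mem 0⟩, ⟨hx, h0, .inr ⟨rfl, hz⟩⟩, ?_⟩
      rintro ⟨y, hy⟩ ⟨-, hyk, h1 | h1⟩
      · exact (hz y hyk h1).elim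
      · exact Subtype.ext h1.1
  · rintro ⟨y, hyN⟩ hy
    obtain ⟨β, hβ, rfl⟩ := Ordinal.mem_toZFSet_iff.1 hy
    obtain ⟨x, hx, hxy⟩ := hcon β hβ
    exact ⟨⟨x, hN.transitive _ (hN.ordinal_mem α) _ hx⟩, hx,
      mapsTo_iff.2 ((hFm _ _).2 ⟨hx, hy, .inl hxy⟩)⟩

end Closure

/-! ### Rank functions and enumerations inside an inner model -/

section Rank

variable {N : Set ZFSet.{u}} [hN : IsInnerModel N]

instance factOrdinalMem (α : Ordinal.{u}) : Fact (α.toZFSet ∈ N) := ⟨hN.ordinal_mem α⟩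

/-- Recursion theorem for rank functions: an inner model contains the rank function `ρ` of every
definable well-founded relation `R` on one of its elements. The function is the union of all its
approximations in `N`; adding one more point to this union would give another approximation, so
every point is reached. -/
theorem exists_rank_graph {A : ZFSet.{u}} (hA : A ∈ N) (R : ZFSet.{u} → ZFSet.{u} → Prop)
    [hR : IsDefPred N (fun v : Fin 2 → N => R (v 0) (v 1))] (ρ : ZFSet.{u} → Ordinal.{u})
    (hρ : ∀ x ∈ A, ∀ ξ, ξ < ρ x ↔ ∃ y ∈ A, R y x ∧ ξ ≤ ρ y) :
    ∃ F ∈ N, ∀ x y, ZFSet.pair x y ∈ F ↔ x ∈ A ∧ y = (ρ x).toZFSet := by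
  have : Fact (A ∈ N) := ⟨hA⟩
  have hR' : ∀ {κ : Type} {s t : (κ → N) → ZFSet.{u}} [IsDefTerm N s] [IsDefTerm N t],
      IsDefPred N (fun v => R (s v) (t v)) :=
    have : IsDefRel N R := ⟨hR⟩
    IsDefPred.rel
  -- an ordinal above all ranks makes the quantifiers over values bounded
  obtain ⟨θ, hθ⟩ : ∃ θ, ∀ x ∈ A, ρ x < θ := by
    have : Small.{u} (A : Set ZFSet.{u}) := inferInstanceAs (Small.{u} {x // x ∈ A})
    obtain ⟨θ, hθ⟩ := Ordinal.bddAbove_of_small (s := ρ '' (A : Set ZFSet.{u}))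
    exact ⟨Order.succ θ, fun x hx => Order.lt_succ_of_le (hθ ⟨x, hx, rfl⟩)⟩
  let B := θ.toZFSet
  -- `Att f`: on its domain, which is closed under `R`-predecessors, `f` satisfies the recursion
  let Att : ZFSet.{u} → Prop := fun f => ∀ x ∈ A, ∀ ξ ∈ B, ZFSet.pair x ξ ∈ f →
    (∀ ζ ∈ B, ζ ∈ ξ ↔ ∃ y ∈ A, R y x ∧ ∃ η ∈ B, ZFSet.pair y η ∈ f ∧ (ζ = η ∨ ζ ∈ η)) ∧
    (∀ y ∈ A, R y x → ∃ η ∈ B, ZFSet.pair y η ∈ f)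
  have hB : ∀ x ∈ A, (ρ x).toZFSet ∈ B := fun x hx =>
    Ordinal.toZFSet_mem_toZFSet_iff.2 (hθ x hx)
  have hval : ∀ f, Att f → ∀ α, ∀ x ∈ A, ρ x = α → ∀ ξ ∈ B, ZFSet.pair x ξ ∈ f →
      ξ = (ρ x).toZFSet := by
    intro f hf α
    induction α using WellFoundedLT.induction with
    | _ α ih =>
      intro x hx hα ξ hξ hxf
      obtain ⟨ξ, hξθ, rfl⟩ := Ordinal.mem_toZFSet_iff.1 hξ
      congr 1
      obtain ⟨h1, h2⟩ := hf x hx _ hξ hxf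
      have hlt : ∀ y ∈ A, R y x → ρ y < α := fun y hy hyx =>
        hα ▸ (hρ x hx _).2 ⟨y, hy, hyx, le_rfl⟩
      have key : ∀ ζ < θ, ζ < ξ ↔ ζ < ρ x := by
        intro ζ hζ
        rw [← Ordinal.toZFSet_mem_toZFSet_iff,
          h1 _ (Ordinal.toZFSet_mem_toZFSet_iff.2 hζ), hρ x hx]
        refine exists_congr fun y => and_congr_right fun hy => and_congr_right fun hyx => ?_
        constructor
        · rintro ⟨η, hη, hyη, h⟩
          rw [ih _ (hlt y hy hyx) y hy rfl η hη hyη] at h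
          rcases h with h | h
          · exact (Ordinal.toZFSet_injective h).le
          · exact (Ordinal.toZFSet_mem_toZFSet_iff.1 h).le
        · intro h
          obtain ⟨η, hη, hyη⟩ := h2 y hy hyx
          have := ih _ (hlt y hy hyx) y hy rfl η hη hyη
          refine ⟨η, hη, hyη, ?_⟩
          rw [this]
          rcases h.eq_or_lt with h | h
          · exact .inl (h ▸ rfl)
          · exact .inr (Ordinal.toZFSet_mem_toZFSet_iff.2 h)
      apply le_antisymm
      · by_contra! h
        exact lt_irrefl _ ((key _ (hθ x hx)).1 h)
      · by_contra! h
        exact lt_irrefl _ ((key _ hξθ).2 h)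
  obtain ⟨F, hF, hFp, hFm⟩ := exists_graph_mem_class hA (hN.ordinal_mem θ)
    (fun x ξ => ∃ f ∈ N, Att f ∧ ZFSet.pair x ξ ∈ f)
  have hFv : ∀ x ξ, ZFSet.pair x ξ ∈ F → ξ = (ρ x).toZFSet := by
    intro x ξ h
    obtain ⟨hx, hξ, f, hf, hAtt, hxf⟩ := (hFm x ξ).1 h
    exact hval f hAtt _ x hx rfl ξ hξ hxf
  have hFc : ∀ x ξ, ZFSet.pair x ξ ∈ F → ∀ y ∈ A, R y x → ZFSet.pair y (ρ y).toZFSet ∈ F := by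
    intro x ξ h y hy hyx
    obtain ⟨hx, hξ, f, hf, hAtt, hxf⟩ := (hFm x ξ).1 h
    obtain ⟨η, hη, hyf⟩ := (hAtt x hx ξ hξ hxf).2 y hy hyx
    obtain rfl := hval f hAtt _ y hy rfl η hη hyf
    exact (hFm _ _).2 ⟨hy, hη, f, hf, hAtt, hyf⟩
  have htot : ∀ α, ∀ x ∈ A, ρ x = α → ZFSet.pair x (ρ x).toZFSet ∈ F := by
    intro α
    induction α using WellFoundedLT.induction with
    | _ α ih =>
      intro x hx hα
      have hxN := hN.transitive _ hA _ hx
      refine (hFm _ _).2 ⟨hx, hB x hx, insert (ZFSet.pair x (ρ x).toZFSet) F,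
        insert_mem_class (pair_mem_class hxN (hN.ordinal_mem _)) hF, ?_, ZFSet.mem_insert _ _⟩
      intro y hy ξ hξ hyf
      have hpred : ξ = (ρ y).toZFSet ∧ ∀ z ∈ A, R z y → ZFSet.pair z (ρ z).toZFSet ∈ F := by
        rcases ZFSet.mem_insert_iff.1 hyf with h | h
        · obtain ⟨rfl, rfl⟩ := ZFSet.pair_inj.1 h
          exact ⟨rfl, fun z hz hzy => ih _ (hα ▸ (hρ _ hx _).2 ⟨z, hz, hzy, le_rfl⟩) z hz rfl⟩
        · exact ⟨hFv _ _ h, hFc _ _ h⟩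
      obtain ⟨rfl, hpred⟩ := hpred
      refine ⟨fun ζ hζ => ?_, fun z hz hzy => ⟨_, hB z hz, ZFSet.mem_insert_of_mem _
        (hpred z hz hzy)⟩⟩
      obtain ⟨ζ, hζθ, rfl⟩ := Ordinal.mem_toZFSet_iff.1 hζ
      rw [Ordinal.toZFSet_mem_toZFSet_iff, hρ y hy]
      refine exists_congr fun z => and_congr_right fun hz => and_congr_right fun hzy => ?_
      constructor
      · intro h
        refine ⟨_, hB z hz, ZFSet.mem_insert_of_mem _ (hpred z hz hzy), ?_⟩
        rcases h.eq_or_lt with h | h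
        · exact .inl (h ▸ rfl)
        · exact .inr (Ordinal.toZFSet_mem_toZFSet_iff.2 h)
      · rintro ⟨η, hη, hzη, h⟩
        obtain rfl : η = (ρ z).toZFSet := by
          rcases ZFSet.mem_insert_iff.1 hzη with h | h
          · obtain ⟨rfl, rfl⟩ := ZFSet.pair_inj.1 h
            rfl
          · exact hFv _ _ h
        rcases h with h | h
        · exact (Ordinal.toZFSet_injective h).le
        · exact (Ordinal.toZFSet_mem_toZFSet_iff.1 h).le
  refine ⟨F, hF, fun x y => ⟨fun h => ⟨((hFm x y).1 h).1, hFv _ _ h⟩, ?_⟩⟩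
  rintro ⟨hx, rfl⟩
  exact htot _ x hx rfl

omit hN in
/-- Every well-founded relation on a set has an ordinal-valued rank function. -/
theorem exists_rank_function (A : ZFSet.{u}) (R : ZFSet.{u} → ZFSet.{u} → Prop)
    (hwf : WellFounded fun x y : {x // x ∈ A} => R x y) :
    ∃ ρ : ZFSet.{u} → Ordinal.{u}, ∀ x ∈ A, ∀ ξ, ξ < ρ x ↔ ∃ y ∈ A, R y x ∧ ξ ≤ ρ y := by
  classical
  let e := equivShrink {x // x ∈ A}
  let r : Shrink.{u} {x // x ∈ A} → Shrink.{u} {x // x ∈ A} → Prop :=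
    fun x y => R (e.symm x) (e.symm y)
  have : IsWellFounded _ r := ⟨InvImage.wf e.symm hwf⟩
  refine ⟨fun x => if h : x ∈ A then IsWellFounded.rank r (e ⟨x, h⟩) else 0, ?_⟩
  intro x hx ξ
  simp only [hx, dif_pos]
  rw [IsWellFounded.rank_eq, Ordinal.lt_iSup_iff]
  constructor
  · rintro ⟨⟨b, hb⟩, h⟩
    refine ⟨e.symm b, (e.symm b).2, by simpa [r] using hb, ?_⟩
    simpa using Order.lt_succ_iff.1 h
  · rintro ⟨y, hy, hyx, h⟩
    refine ⟨⟨e ⟨y, hy⟩, by simpa [r] using hyx⟩, Order.lt_succ_iff.2 ?_⟩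
    simpa [hy] using h

omit hN in
/-- A set injects into another one as soon as a relation with disjoint sections relates each of
its elements to an element of the other set. -/
theorem card_le_of_rel {a b : ZFSet.{u}} (R : ZFSet.{u} → ZFSet.{u} → Prop)
    (htot : ∀ x ∈ a, ∃ y ∈ b, R x y)
    (hinj : ∀ x ∈ a, ∀ x' ∈ a, ∀ y ∈ b, R x y → R x' y → x = x') : a.card ≤ b.card := by
  rw [← Cardinal.lift_le.{u + 1}, ← ZFSet.cardinalMk_coe_sort, ← ZFSet.cardinalMk_coe_sort]
  choose f hf hR using htot
  refine Cardinal.mk_le_of_injective (f := fun x : {x // x ∈ a} => (⟨f x x.2, hf x x.2⟩ :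
    {y // y ∈ b})) ?_
  intro x x' h
  have h : f x x.2 = f x' x'.2 := congrArg Subtype.val h
  exact Subtype.ext (hinj _ x.2 _ x'.2 _ (hf x x.2) (hR x x.2) (h ▸ hR x' x'.2))

/-- The increasing enumeration of a set of ordinals in an inner model belongs to the inner
model. -/
theorem exists_enumeration {γ : Ordinal.{u}} {E : ZFSet.{u}} (hE : E ∈ N)
    (hEγ : E ⊆ γ.toZFSet) :
    ∃ o ≤ γ, E.card = o.card ∧ ∃ F ∈ N,
      (∀ p ∈ F, ∃ x ∈ o.toZFSet, ∃ y ∈ E, p = ZFSet.pair x y) ∧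
      (∀ x ∈ o.toZFSet, ∃! y, ZFSet.pair x y ∈ F) ∧
      (∀ y ∈ E, ∃ x ∈ o.toZFSet, ZFSet.pair x y ∈ F) := by
  obtain ⟨ρ, hρ⟩ := exists_rank_function E (fun x y => x ∈ y)
    (InvImage.wf (fun x : {x // x ∈ E} => (x : ZFSet.{u})) ZFSet.mem_wf)
  obtain ⟨G, hG, hGm⟩ := exists_rank_graph hE (fun x y => x ∈ y) ρ hρ
  have : Fact (G ∈ N) := ⟨hG⟩
  have hmono : ∀ x ∈ E, ∀ y ∈ E, x ∈ y → ρ x < ρ y := fun x hx y hy h =>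
    (hρ y hy _).2 ⟨x, hx, h, le_rfl⟩
  have hinj : ∀ x ∈ E, ∀ y ∈ E, ρ x = ρ y → x = y := by
    intro x hx y hy h
    obtain ⟨α, -, rfl⟩ := Ordinal.mem_toZFSet_iff.1 (hEγ hx)
    obtain ⟨β, -, rfl⟩ := Ordinal.mem_toZFSet_iff.1 (hEγ hy)
    rcases lt_trichotomy α β with h1 | h1 | h1
    · exact absurd h (hmono _ hx _ hy (Ordinal.toZFSet_mem_toZFSet_iff.2 h1)).ne
    · rw [h1]
    · exact absurd h (hmono _ hy _ hx (Ordinal.toZFSet_mem_toZFSet_iff.2 h1)).ne'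
  have hle : ∀ α : Ordinal.{u}, α.toZFSet ∈ E → ρ α.toZFSet ≤ α := by
    intro α
    induction α using WellFoundedLT.induction with
    | _ α ih =>
      intro hα
      by_contra! h
      obtain ⟨y, hy, hyα, h⟩ := (hρ _ hα _).1 h
      obtain ⟨β, hβ, rfl⟩ := Ordinal.mem_toZFSet_iff.1 hyα
      exact (h.trans (ih β hβ hy)).not_gt hβ
  have hltγ : ∀ y ∈ E, ρ y < γ := by
    intro y hy
    obtain ⟨α, hα, rfl⟩ := Ordinal.mem_toZFSet_iff.1 (hEγ hy)
    exact (hle α hy).trans_lt hα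
  have hdown : ∀ β, ∀ x ∈ E, ρ x = β → ∀ ξ < β, ∃ y ∈ E, ρ y = ξ := by
    intro β
    induction β using WellFoundedLT.induction with
    | _ β ih =>
      rintro x hx rfl ξ hξ
      obtain ⟨y, hy, hyx, h⟩ := (hρ x hx ξ).1 hξ
      rcases h.eq_or_lt with h | h
      · exact ⟨y, hy, h.symm⟩
      · exact ih _ (hmono y hy x hx hyx) y hy rfl ξ h
  -- the order type of `E` is the least ordinal that is not a value of `ρ`
  let S : Set Ordinal.{u} := {ξ | ∀ y ∈ E, ρ y ≠ ξ}
  have hγS : γ ∈ S := fun y hy => (hltγ y hy).ne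
  have hoS : sInf S ∈ S := csInf_mem ⟨γ, hγS⟩
  have hsurj : ∀ ξ < sInf S, ∃ y ∈ E, ρ y = ξ := by
    intro ξ hξ
    have := notMem_of_lt_csInf' hξ
    simpa [S] using this
  have hlt : ∀ y ∈ E, ρ y < sInf S := by
    intro y hy
    by_contra! h
    rcases h.eq_or_lt with h | h
    · exact hoS y hy h.symm
    · obtain ⟨z, hz, hzS⟩ := hdown _ y hy rfl _ h
      exact hoS z hz hzS
  obtain ⟨F, hF, hFp, hFm⟩ := exists_graph_mem_class (hN.ordinal_mem (sInf S)) hE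
    (fun x y => ZFSet.pair y x ∈ G)
  have hF' : ∀ x y, ZFSet.pair x y ∈ F ↔ y ∈ E ∧ x = (ρ y).toZFSet := by
    intro x y
    rw [hFm, hGm]
    refine ⟨fun h => h.2.2, fun h => ⟨?_, h.1, h⟩⟩
    rw [h.2]
    exact Ordinal.toZFSet_mem_toZFSet_iff.2 (hlt y h.1)
  refine ⟨sInf S, csInf_le' hγS, ?_, F, hF, hFp, ?_, ?_⟩
  · rw [← Ordinal.card_toZFSet]
    apply le_antisymm
    · refine card_le_of_rel (fun y x => x = (ρ y).toZFSet)
        (fun y hy => ⟨_, Ordinal.toZFSet_mem_toZFSet_iff.2 (hlt y hy), rfl⟩) ?_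
      rintro y hy y' hy' x - h h'
      exact hinj y hy y' hy' (Ordinal.toZFSet_injective (h.symm.trans h'))
    · refine card_le_of_rel (fun x y => x = (ρ y).toZFSet) ?_ ?_
      · intro x hx
        obtain ⟨ξ, hξ, rfl⟩ := Ordinal.mem_toZFSet_iff.1 hx
        obtain ⟨y, hy, rfl⟩ := hsurj ξ hξ
        exact ⟨y, hy, rfl⟩
      · rintro x - x' - y - rfl rfl
        rfl
  · intro x hx
    obtain ⟨ξ, hξ, rfl⟩ := Ordinal.mem_toZFSet_iff.1 hx
    obtain ⟨y, hy, rfl⟩ := hsurj ξ hξ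
    refine ⟨y, (hF' _ _).2 ⟨hy, rfl⟩, fun z hz => ?_⟩
    obtain ⟨hz, h⟩ := (hF' _ _).1 hz
    exact (hinj y hy z hz (Ordinal.toZFSet_injective h)).symm
  · intro y hy
    exact ⟨_, Ordinal.toZFSet_mem_toZFSet_iff.2 (hlt y hy), (hF' _ _).2 ⟨hy, rfl⟩⟩

/-- An unbounded subset, in an inner model, of an ordinal that is regular there has the same
cardinality as that ordinal. -/
theorem card_le_card_of_unbounded {γ : Ordinal.{u}} (hγ : RegularInClass N γ) {E : ZFSet.{u}}
    (hE : E ∈ N) (hEγ : E ⊆ γ.toZFSet) (hunb : ∀ β < γ, ∃ ξ ≥ β, ξ.toZFSet ∈ E) :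
    γ.card ≤ E.card := by
  obtain ⟨hγN, hreg⟩ := hγ
  obtain ⟨o, hoγ, hcard, F, hF, hFp, hFfun, hFsurj⟩ := exists_enumeration hE hEγ
  rcases hoγ.eq_or_lt with rfl | ho
  · exact hcard.ge
  refine (hreg.2 ⟨o.toZFSet, hN.ordinal_mem o⟩ (Ordinal.toZFSet_mem_toZFSet_iff.2 ho)
    ⟨⟨F, hF⟩, ⟨?_, ?_⟩, ?_⟩).elim
  · rintro ⟨p, hp⟩ hpF
    obtain ⟨x, hx, y, hy, rfl⟩ := hFp p hpF
    exact ⟨⟨x, hN.transitive _ (hN.ordinal_mem o) _ hx⟩, ⟨y, hN.transitive _ hE _ hy⟩, hx,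
      hEγ hy, isOrderedPair_iff.2 rfl⟩
  · rintro ⟨x, hxN⟩ hx
    obtain ⟨y, hy, huniq⟩ := hFfun x hx
    obtain ⟨x', -, y', hy', h⟩ := hFp _ hy
    have hyE : y ∈ E := (ZFSet.pair_inj.1 h).2 ▸ hy'
    exact ⟨⟨y, hN.transitive _ hE _ hyE⟩, mapsTo_iff.2 hy,
      fun z hz => Subtype.ext (huniq _ (mapsTo_iff.1 hz))⟩
  · rintro ⟨b, hbN⟩ hb
    obtain ⟨β, hβ, rfl⟩ := Ordinal.mem_toZFSet_iff.1 hb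
    obtain ⟨ξ, hξ, hξE⟩ := hunb β hβ
    obtain ⟨x, hx, hxF⟩ := hFsurj _ hξE
    refine ⟨⟨x, hN.transitive _ (hN.ordinal_mem o) _ hx⟩, ⟨_, hN.ordinal_mem ξ⟩, hx,
      mapsTo_iff.2 hxF, ?_⟩
    rcases hξ.eq_or_lt with h | h
    · exact .inl (Subtype.ext (h ▸ rfl))
    · exact .inr (Ordinal.toZFSet_mem_toZFSet_iff.2 h)

end Rank

/-! ### Normal fine measures -/

section Measure

variable {δ : Cardinal.{u}} {γ : Ordinal.{u}} {U : ZFSet.{u}}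

theorem mem_Pset {σ : ZFSet.{u}} : σ ∈ Pset δ γ ↔ σ ⊆ γ.toZFSet ∧ σ.card < δ := by
  simp [Pset]

/-- The filter on the class of all sets generated by a normal fine measure. -/
def IsNormalFineMeasure.filter (hU : IsNormalFineMeasure δ γ U) : Filter ZFSet.{u} where
  sets := {S | ZFSet.sep (· ∈ S) (Pset δ γ) ∈ U}
  univ_sets := by
    have : ZFSet.sep (· ∈ Set.univ) (Pset δ γ) = Pset δ γ := by ext; simp
    simpa only [Set.mem_ofPred_eq, this] using hU.univ_mem
  sets_of_superset {S T} hS hST := by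
    simp only [Set.mem_ofPred_eq] at hS ⊢
    exact hU.mem_of_superset _ hS _
      (fun σ hσ => ZFSet.mem_sep.2 ⟨(ZFSet.mem_sep.1 hσ).1, hST (ZFSet.mem_sep.1 hσ).2⟩)
      (fun σ hσ => (ZFSet.mem_sep.1 hσ).1)
  inter_sets {S T} hS hT := by
    simp only [Set.mem_ofPred_eq] at hS hT ⊢
    convert hU.inter_mem _ hS _ hT using 1
    ext σ
    simp only [ZFSet.mem_sep, ZFSet.mem_inter, Set.mem_inter_iff]
    tauto

theorem IsNormalFineMeasure.eventually_iff (hU : IsNormalFineMeasure δ γ U)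
    {p : ZFSet.{u} → Prop} :
    (∀ᶠ σ in hU.filter, p σ) ↔ ZFSet.sep p (Pset δ γ) ∈ U := by
  change {σ | p σ} ∈ {S : Set ZFSet.{u} | ZFSet.sep (· ∈ S) (Pset δ γ) ∈ U} ↔ _
  simp only [Set.mem_ofPred_eq]

theorem IsNormalFineMeasure.neBot (hU : IsNormalFineMeasure δ γ U) : hU.filter.NeBot := by
  refine ⟨fun h => hU.empty_notMem ?_⟩
  have h : ∀ᶠ _ in hU.filter, False := by simp [h]
  convert hU.eventually_iff.1 h
  ext
  simp

theorem IsNormalFineMeasure.eventually_not (hU : IsNormalFineMeasure δ γ U)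
    {p : ZFSet.{u} → Prop} (h : ¬ ∀ᶠ σ in hU.filter, p σ) : ∀ᶠ σ in hU.filter, ¬ p σ := by
  rw [hU.eventually_iff] at h ⊢
  convert (hU.mem_or_compl_mem _ ZFSet.sep_subset).resolve_left h
  ext σ
  simp only [ZFSet.mem_sep, ZFSet.mem_sdiff]
  tauto

theorem IsNormalFineMeasure.eventually_of_forall_mem (hU : IsNormalFineMeasure δ γ U)
    {X : ZFSet.{u}} (hX : X ∈ U) {p : ZFSet.{u} → Prop} (h : ∀ σ ∈ X, p σ) :
    ∀ᶠ σ in hU.filter, p σ :=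
  hU.eventually_iff.2 <| hU.mem_of_superset X hX _
    (fun σ hσ => ZFSet.mem_sep.2 ⟨hU.subset X hX hσ, h σ hσ⟩) ZFSet.sep_subset

theorem IsNormalFineMeasure.eventually_mem_Pset (hU : IsNormalFineMeasure δ γ U) :
    ∀ᶠ σ in hU.filter, σ ∈ Pset δ γ :=
  hU.eventually_of_forall_mem hU.univ_mem fun _ h => h

theorem IsNormalFineMeasure.eventually_mem (hU : IsNormalFineMeasure δ γ U) {α : Ordinal.{u}}
    (hα : α < γ) : ∀ᶠ σ in hU.filter, α.toZFSet ∈ σ :=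
  hU.eventually_iff.2 (hU.fine _ (Ordinal.toZFSet_mem_toZFSet_iff.2 hα))

/-- Normality, for relations instead of regressive functions. -/
theorem IsNormalFineMeasure.exists_eventually (hU : IsNormalFineMeasure δ γ U)
    {p : ZFSet.{u} → ZFSet.{u} → Prop} (h : ∀ᶠ σ in hU.filter, ∃ x ∈ σ, p x σ) :
    ∃ α < γ, ∀ᶠ σ in hU.filter, p α.toZFSet σ := by
  classical
  rw [hU.eventually_iff] at h
  obtain ⟨Y, hY, hYX, α, hα, hf⟩ := hU.normal _ h
    (fun σ => if h : ∃ x ∈ σ, p x σ then h.choose else ∅) (fun σ hσ => by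
      have := (ZFSet.mem_sep.1 hσ).2
      rw [dif_pos this]
      exact this.choose_spec.1)
  obtain ⟨α, hα', rfl⟩ := Ordinal.mem_toZFSet_iff.1 hα
  refine ⟨α, hα', hU.eventually_of_forall_mem hY fun σ hσ => ?_⟩
  have h1 := (ZFSet.mem_sep.1 (hYX hσ)).2
  have h2 := hf σ hσ
  rw [dif_pos h1] at h2
  rw [← h2]
  exact h1.choose_spec.2

/-- By completeness, almost every set includes a given set of fewer than `δ` elements. -/
theorem IsNormalFineMeasure.eventually_subset (hU : IsNormalFineMeasure δ γ U) {D : ZFSet.{u}}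
    (hD : D ⊆ γ.toZFSet) (hcard : D.card < δ) : ∀ᶠ σ in hU.filter, D ⊆ σ := by
  rcases ZFSet.eq_empty_or_nonempty D with rfl | ⟨d, hd⟩
  · simp
  let S : ZFSet.{u} → ZFSet.{u} := fun x => ZFSet.sep (fun σ => x ∈ σ) (Pset δ γ)
  let A : ZFSet.{u} := ZFSet.range fun x : Shrink.{u} {x // x ∈ D} =>
    S ((equivShrink {x // x ∈ D}).symm x : ZFSet.{u})
  have hA : ∀ X, X ∈ A ↔ ∃ x ∈ D, S x = X := by
    intro X
    rw [ZFSet.mem_range]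
    constructor
    · rintro ⟨x, rfl⟩
      exact ⟨_, ((equivShrink {x // x ∈ D}).symm x).2, rfl⟩
    · rintro ⟨x, hx, rfl⟩
      exact ⟨equivShrink _ ⟨x, hx⟩, by simp⟩
  have hne : A.Nonempty := ⟨S d, (hA _).2 ⟨d, hd, rfl⟩⟩
  have hAD : A.card ≤ D.card := by
    refine card_le_of_rel (fun X x => S x = X) (fun X hX => (hA X).1 hX) ?_
    rintro X - X' - y - rfl rfl
    rfl
  refine hU.eventually_of_forall_mem (hU.complete A ?_ hne (hAD.trans_lt hcard)) ?_
  · intro X hX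
    obtain ⟨x, hx, rfl⟩ := (hA X).1 hX
    exact hU.fine x (hD hx)
  · intro σ hσ x hx
    exact (ZFSet.mem_sep.1 ((ZFSet.mem_sInter hne).1 hσ _ ((hA _).2 ⟨x, hx, rfl⟩))).2

end Measure

section WeakExtenderModel

variable {N : Set ZFSet.{u}} {δ : Cardinal.{u}}

/-- A weak extender model contains all ordinals: by fineness, every ordinal belongs to some element
of the model. -/
theorem IsWeakExtenderModel.isInnerModel (hN : IsWeakExtenderModel N δ) : IsInnerModel N where
  transitive := hN.transitive
  zfc := hN.zfc
  ordinal_mem α := by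
    have hlt : α < Order.succ (max α δ.ord) := Order.lt_succ_of_le (le_max_left _ _)
    obtain ⟨U, hU, hconc, -⟩ := hN.measures (Order.succ (max α δ.ord))
      (Order.lt_succ_of_le (le_max_right _ _))
    have := hU.neBot
    obtain ⟨σ, hσN, hσ⟩ := ((hU.eventually_iff.2 hconc).and (hU.eventually_mem hlt)).exists
    exact hN.transitive _ hσN _ hσ

/-- Inside an inner model, smallness of a set of ordinals, in the sense of `V`, is witnessed by a
map from an ordinal below `δ`. -/
theorem card_lt_iff [hN : IsInnerModel N] {γ : Ordinal.{u}} {σ : ZFSet.{u}} (hσ : σ ∈ N)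
    (hσγ : σ ⊆ γ.toZFSet) :
    σ.card < δ ↔ ∃ a ∈ δ.ord.toZFSet, ∃ f ∈ N,
      (∀ x ∈ a, ∀ y ∈ σ, ∀ z ∈ σ, ZFSet.pair x y ∈ f → ZFSet.pair x z ∈ f → y = z) ∧
      ∀ y ∈ σ, ∃ x ∈ a, ZFSet.pair x y ∈ f := by
  constructor
  · intro h
    obtain ⟨o, -, hcard, F, hF, -, hfun, hsurj⟩ := exists_enumeration hσ hσγ
    refine ⟨o.toZFSet, ?_, F, hF, ?_, hsurj⟩
    · rw [Ordinal.toZFSet_mem_toZFSet_iff, Cardinal.lt_ord, ← hcard]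
      exact h
    · intro x hx y _ z _ hy hz
      exact (hfun x hx).unique hy hz
  · rintro ⟨a, ha, f, -, hfun, hsurj⟩
    obtain ⟨α, hα, rfl⟩ := Ordinal.mem_toZFSet_iff.1 ha
    refine lt_of_le_of_lt ?_ (Cardinal.lt_ord.1 hα)
    rw [← Ordinal.card_toZFSet]
    exact card_le_of_rel (fun y x => ZFSet.pair x y ∈ f) hsurj
      fun y hy z hz x hx h1 h2 => hfun x hx y hy z hz h1 h2

variable (N δ) in
/-- The elements of `N` in `𝒫_δ(γ)` that have no largest element. -/
noncomputable def limitSets (γ : Ordinal.{u}) : ZFSet.{u} :=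
  ZFSet.sep (fun σ => σ ∈ N ∧ ∀ x ∈ σ, ∃ y ∈ σ, x ∈ y) (Pset δ γ)

theorem mem_limitSets {γ : Ordinal.{u}} {σ : ZFSet.{u}} :
    σ ∈ limitSets N δ γ ↔
      σ ∈ N ∧ σ ⊆ γ.toZFSet ∧ σ.card < δ ∧ ∀ x ∈ σ, ∃ y ∈ σ, x ∈ y := by
  simp only [limitSets, ZFSet.mem_sep, mem_Pset]
  tauto

theorem limitSets_mem_class [hN : IsInnerModel N] (γ : Ordinal.{u}) : limitSets N δ γ ∈ N := by
  have h := sep_mem_class (powersetIn_mem_class (hN.ordinal_mem γ))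
    (fun σ => (∀ x ∈ σ, ∃ y ∈ σ, x ∈ y) ∧ ∃ a ∈ δ.ord.toZFSet, ∃ f ∈ N,
      (∀ x ∈ a, ∀ y ∈ σ, ∀ z ∈ σ, ZFSet.pair x y ∈ f → ZFSet.pair x z ∈ f → y = z) ∧
      ∀ y ∈ σ, ∃ x ∈ a, ZFSet.pair x y ∈ f)
  convert h using 1
  ext σ
  rw [mem_limitSets, ZFSet.mem_sep, mem_powersetIn]
  constructor
  · rintro ⟨h1, h2, h3, h4⟩
    exact ⟨⟨h2, h1⟩, h4, (card_lt_iff h1 h2).1 h3⟩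
  · rintro ⟨⟨h2, h1⟩, h4, h3⟩
    exact ⟨h1, h2, (card_lt_iff h1 h2).2 h3, h4⟩

/-- The axiom of choice in an inner model, in the form: a definable equivalence relation on an
element of the model has a transversal in the model. -/
theorem exists_transversal [hN : IsInnerModel N] {P : ZFSet.{u}} (hP : P ∈ N)
    (R : ZFSet.{u} → ZFSet.{u} → Prop) [hR : IsDefPred N (fun v : Fin 2 → N => R (v 0) (v 1))]
    (hrefl : ∀ x ∈ P, R x x) (hsymm : ∀ x ∈ P, ∀ y ∈ P, R x y → R y x)
    (htrans : ∀ x ∈ P, ∀ y ∈ P, ∀ z ∈ P, R x y → R y z → R x z) :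
    ∃ c ∈ N, c ⊆ P ∧ ∀ x ∈ P, ∃! y, y ∈ c ∧ R x y := by
  have : Fact (P ∈ N) := ⟨hP⟩
  have hR' : ∀ {κ : Type} {s t : (κ → N) → ZFSet.{u}} [IsDefTerm N s] [IsDefTerm N t],
      IsDefPred N (fun v => R (s v) (t v)) :=
    have : IsDefRel N R := ⟨hR⟩
    IsDefPred.rel
  have hF := sep_mem_class (powersetIn_mem_class hP)
    (fun Y => ∃ x ∈ P, ∀ y ∈ P, y ∈ Y ↔ R x y)
  set F := ZFSet.sep (fun Y => ∃ x ∈ P, ∀ y ∈ P, y ∈ Y ↔ R x y) (powersetIn N P) with hFdef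
  have hFm : ∀ Y, Y ∈ F ↔ Y ⊆ P ∧ Y ∈ N ∧ ∃ x ∈ P, ∀ y ∈ P, y ∈ Y ↔ R x y := by
    intro Y
    rw [hFdef, ZFSet.mem_sep, mem_powersetIn, and_assoc]
  obtain ⟨⟨c, hc⟩, hcF⟩ := hN.zfc.choice ⟨F, hF⟩ (by
    rintro ⟨Y, hYN⟩ hY
    obtain ⟨-, -, x, hx, h⟩ := (hFm Y).1 hY
    exact ⟨⟨x, hN.transitive _ hP _ hx⟩, (h x hx).2 (hrefl x hx)⟩) (by
    rintro ⟨Y, hYN⟩ ⟨Z, hZN⟩ ⟨z, hzN⟩ hY hZ hzY hzZ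
    obtain ⟨hYP, -, x, hx, h⟩ := (hFm Y).1 hY
    obtain ⟨hZP, -, x', hx', h'⟩ := (hFm Z).1 hZ
    have hzY : z ∈ Y := hzY
    have hzZ : z ∈ Z := hzZ
    have hzP := hYP hzY
    have h1 := (h z hzP).1 hzY
    have h2 := (h' z hzP).1 hzZ
    refine Subtype.ext (ZFSet.ext fun y => ?_)
    constructor
    · intro hy
      have hyP := hYP hy
      refine (h' y hyP).2 (htrans _ hx' _ hzP _ hyP h2 ?_)
      exact htrans _ hzP _ hx _ hyP (hsymm _ hx _ hzP h1) ((h y hyP).1 hy)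
    · intro hy
      have hyP := hZP hy
      refine (h y hyP).2 (htrans _ hx _ hzP _ hyP h1 ?_)
      exact htrans _ hzP _ hx' _ hyP (hsymm _ hx' _ hzP h2) ((h' y hyP).1 hy))
  have : Fact (c ∈ N) := ⟨hc⟩
  refine ⟨_, sep_mem_class hP (fun x => x ∈ c), ZFSet.sep_subset, fun x hx => ?_⟩
  have : Fact (x ∈ N) := ⟨hN.transitive _ hP _ hx⟩
  have hYN := sep_mem_class hP (fun y => R x y)
  obtain ⟨⟨y, hyN⟩, ⟨hyc, hyY⟩, huniq⟩ := hcF ⟨_, hYN⟩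
    ((hFm _).2 ⟨ZFSet.sep_subset, hYN, x, hx, fun y hy => by simp [hy]⟩)
  obtain ⟨hyP, hxy⟩ := ZFSet.mem_sep.1 hyY
  refine ⟨y, ⟨ZFSet.mem_sep.2 ⟨hyP, hyc⟩, hxy⟩, ?_⟩
  rintro z ⟨hz, hxz⟩
  obtain ⟨hzP, hzc⟩ := ZFSet.mem_sep.1 hz
  exact congrArg Subtype.val (huniq ⟨z, hN.transitive _ hc _ hzc⟩
    ⟨hzc, ZFSet.mem_sep.2 ⟨hzP, hxz⟩⟩)

end WeakExtenderModel

/-- A cofinal subset of least cardinality. -/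
theorem exists_cofinal_set (γ : Ordinal.{u}) :
    ∃ D : ZFSet.{u}, D ⊆ γ.toZFSet ∧ D.card ≤ γ.cof ∧
      ∀ α < γ, ∃ β ≥ α, β.toZFSet ∈ D := by
  obtain ⟨s, hs, hcard⟩ := Order.exists_cof_eq γ.ToType
  refine ⟨ZFSet.range fun x : s => (Ordinal.ToType.mk.symm x.1 : Ordinal.{u}).toZFSet, ?_, ?_, ?_⟩
  · intro x hx
    obtain ⟨y, rfl⟩ := ZFSet.mem_range.1 hx
    exact Ordinal.toZFSet_mem_toZFSet_iff.2 (Ordinal.ToType.mk.symm y.1).2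
  · rw [← Ordinal.cof_toType, ← hcard]
    simpa using ZFSet.lift_card_range_le
      (f := fun x : s => (Ordinal.ToType.mk.symm x.1 : Ordinal.{u}).toZFSet)
  · intro α hα
    obtain ⟨b, hb, hab⟩ := hs (Ordinal.ToType.mk ⟨α, hα⟩)
    refine ⟨Ordinal.ToType.mk.symm b, ?_, ZFSet.mem_range.2 ⟨⟨b, hb⟩, rfl⟩⟩
    have h : (⟨α, hα⟩ : Set.Iio γ) ≤ Ordinal.ToType.mk.symm b := by
      simpa using Ordinal.ToType.mk.symm.monotone hab
    exact h

/-! ### Cofinality of ordinals that are regular in the model -/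

theorem card_sUnion_le {Q : ZFSet.{u}} {κ : Cardinal.{u}} (h : ∀ τ ∈ Q, τ.card ≤ κ) :
    (ZFSet.sUnion Q).card ≤ Q.card * κ := by
  rw [← Cardinal.lift_le.{u + 1}, Cardinal.lift_mul, ← ZFSet.cardinalMk_coe_sort,
    ← ZFSet.cardinalMk_coe_sort]
  have h1 := Cardinal.mk_sUnion_le (SetLike.coe '' (Q : Set ZFSet.{u}))
  rw [← ZFSet.coe_sUnion] at h1
  refine h1.trans (mul_le_mul' Cardinal.mk_image_le (ciSup_le' ?_))
  rintro ⟨_, τ, hτ, rfl⟩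
  have := Cardinal.lift_le.{u + 1}.2 (h τ hτ)
  rwa [← ZFSet.cardinalMk_coe_sort] at this

/-- Two sets of ordinals without largest elements that have the same supremum. -/
def Interleaved (σ τ : ZFSet.{u}) : Prop :=
  (∀ x ∈ σ, ∃ y ∈ τ, x ∈ y) ∧ ∀ y ∈ τ, ∃ x ∈ σ, y ∈ x

instance IsDefPred.interleaved {N : Set ZFSet.{u}} [IsInnerModel N] {ι : Type}
    {s t : (ι → N) → ZFSet.{u}} [IsDefTerm N s] [IsDefTerm N t] :
    IsDefPred N (fun v => Interleaved (s v) (t v)) :=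
  have : IsDefRel N Interleaved := ⟨by unfold Interleaved; infer_instance⟩
  IsDefPred.rel

theorem isTransitive_of_mem_subset {γ : Ordinal.{u}} {σ x : ZFSet.{u}} (hσ : σ ⊆ γ.toZFSet)
    (hx : x ∈ σ) : x.IsTransitive :=
  ((ZFSet.isOrdinal_toZFSet γ).mem (hσ hx)).isTransitive

section Regular

variable {N : Set ZFSet.{u}} {δ : Cardinal.{u}} {γ : Ordinal.{u}} {U : ZFSet.{u}}

theorem RegularInClass.isSuccLimit [hN : IsInnerModel N] (hreg : RegularInClass N γ) :
    Order.IsSuccLimit γ := by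
  obtain ⟨h, ⟨⟨-, ⟨x, hx⟩, hlim⟩, -⟩⟩ := hreg
  obtain ⟨α, hα, -⟩ := Ordinal.mem_toZFSet_iff.1 (show (x : ZFSet.{u}) ∈ γ.toZFSet from hx)
  rw [Ordinal.isSuccLimit_iff, Order.isSuccPrelimit_iff_succ_lt]
  refine ⟨(bot_le.trans_lt hα).ne', fun β hβ => ?_⟩
  obtain ⟨⟨y, hyN⟩, hy, hβy⟩ := hlim ⟨β.toZFSet, hN.ordinal_mem β⟩
    (Ordinal.toZFSet_mem_toZFSet_iff.2 hβ)
  obtain ⟨η, hη, rfl⟩ := Ordinal.mem_toZFSet_iff.1 (show y ∈ γ.toZFSet from hy)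
  exact (Order.succ_le_of_lt (Ordinal.toZFSet_mem_toZFSet_iff.1 hβy)).trans_lt hη

/-- A largest element of `σ`, if it existed almost everywhere, would be constant by
normality, against fineness. -/
theorem eventually_no_max (hU : IsNormalFineMeasure δ γ U) (hγ : Order.IsSuccLimit γ) :
    ∀ᶠ σ in hU.filter, ∀ x ∈ σ, ∃ y ∈ σ, x ∈ y := by
  by_contra h
  have h' : ∀ᶠ σ in hU.filter, ∃ x ∈ σ, ∀ y ∈ σ, x ∉ y := by
    filter_upwards [hU.eventually_not h] with σ hσ
    push Not at hσ
    exact hσ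
  obtain ⟨α, hα, h'⟩ := hU.exists_eventually h'
  have := hU.neBot
  obtain ⟨σ, hσ, hσα⟩ := (h'.and (hU.eventually_mem (hγ.succ_lt hα))).exists
  exact hσ _ hσα (Ordinal.toZFSet_mem_toZFSet_iff.2 (Order.lt_succ α))

theorem eventually_mem_limitSets (hU : IsNormalFineMeasure δ γ U) (hγ : Order.IsSuccLimit γ)
    (hconc : ZFSet.sep (fun σ => σ ∈ N) (Pset δ γ) ∈ U) :
    ∀ᶠ σ in hU.filter, σ ∈ limitSets N δ γ := by
  filter_upwards [eventually_no_max hU hγ, hU.eventually_iff.2 hconc, hU.eventually_mem_Pset]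
    with σ h1 h2 h3
  rw [mem_Pset] at h3
  exact mem_limitSets.2 ⟨h2, h3.1, h3.2, h1⟩

/-- An unbounded element of `N` would have cardinality at least `|γ| ≥ δ`. -/
theorem bounded_of_mem_limitSets [hN : IsInnerModel N] (hreg : RegularInClass N γ)
    (hδ : δ.ord < γ) {σ : ZFSet.{u}} (hσ : σ ∈ limitSets N δ γ) :
    ∃ β < γ, ∀ x ∈ σ, x ∈ β.toZFSet := by
  obtain ⟨hσN, hσγ, hcard, -⟩ := mem_limitSets.1 hσ
  by_contra! hcon
  refine (hcard.trans_le (Cardinal.ord_le.1 hδ.le)).not_ge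
    (card_le_card_of_unbounded hreg hσN hσγ fun β hβ => ?_)
  obtain ⟨x, hx, hxβ⟩ := hcon β hβ
  obtain ⟨ξ, -, rfl⟩ := Ordinal.mem_toZFSet_iff.1 (hσγ hx)
  rw [Ordinal.toZFSet_mem_toZFSet_iff, not_lt] at hxβ
  exact ⟨ξ, hxβ, hx⟩

/-- A cofinal set with fewer than `δ` elements would be included in almost every `σ`, but almost
every `σ` is bounded. -/
theorem le_cof_of_regularInClass [hN : IsInnerModel N] (hU : IsNormalFineMeasure δ γ U)
    (hreg : RegularInClass N γ) (hδ : δ.ord < γ)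
    (hconc : ZFSet.sep (fun σ => σ ∈ N) (Pset δ γ) ∈ U) : δ ≤ γ.cof := by
  by_contra! h
  obtain ⟨D, hD, hDcard, hDcof⟩ := exists_cofinal_set γ
  have := hU.neBot
  obtain ⟨σ, hDσ, hσ⟩ := ((hU.eventually_subset hD (hDcard.trans_lt h)).and
    (eventually_mem_limitSets hU hreg.isSuccLimit hconc)).exists
  obtain ⟨β, hβ, hσβ⟩ := bounded_of_mem_limitSets hreg hδ hσ
  obtain ⟨ξ, hξ, hξD⟩ := hDcof β hβ
  exact hξ.not_gt (Ordinal.toZFSet_mem_toZFSet_iff.1 (hσβ _ (hDσ hξD)))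

/-- Almost every `σ` is nonempty without largest element, hence infinite. -/
theorem aleph0_lt_of_isNormalFineMeasure (hU : IsNormalFineMeasure δ γ U)
    (hγ : Order.IsSuccLimit γ) : Cardinal.aleph0 < δ := by
  have := hU.neBot
  obtain ⟨σ, ⟨hσ, h0⟩, hσP⟩ := (((eventually_no_max hU hγ).and
    (hU.eventually_mem hγ.bot_lt)).and hU.eventually_mem_Pset).exists
  refine lt_of_le_of_lt ?_ (mem_Pset.1 hσP).2
  rw [← Cardinal.lift_le.{u + 1}, ← ZFSet.cardinalMk_coe_sort, Cardinal.lift_aleph0]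
  have hinf : (σ : Set ZFSet.{u}).Infinite := by
    intro hfin
    obtain ⟨x, hx, hmax⟩ := Set.exists_max_image _ ZFSet.rank hfin ⟨_, h0⟩
    obtain ⟨y, hy, hxy⟩ := hσ x hx
    exact (hmax y hy).not_gt (ZFSet.rank_lt_of_mem hxy)
  have := hinf.to_subtype
  exact Cardinal.aleph0_le_mk (σ : Set ZFSet.{u})

/-- Almost every `σ` has a supremum that is a limit point of a given cofinal set `D`: otherwise, by
normality, some fixed `α` would almost always be the start of a gap in which no element of `D` is
followed by an element of `σ`. -/
theorem eventually_limit_point (hU : IsNormalFineMeasure δ γ U) (hγ : Order.IsSuccLimit γ)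
    {D : ZFSet.{u}} (hD : D ⊆ γ.toZFSet) (hDcof : ∀ α < γ, ∃ β ≥ α, β.toZFSet ∈ D) :
    ∀ᶠ σ in hU.filter, ∀ x ∈ σ, ∃ d ∈ D, ∃ y ∈ σ, x ∈ d ∧ d ∈ y := by
  by_contra h
  have h' : ∀ᶠ σ in hU.filter, ∃ x ∈ σ, ∀ d ∈ D, ∀ y ∈ σ, x ∈ d → d ∉ y := by
    filter_upwards [hU.eventually_not h] with σ hσ
    push Not at hσ
    exact hσ
  obtain ⟨α, hα, h'⟩ := hU.exists_eventually h'
  obtain ⟨β, hβ, hβD⟩ := hDcof _ (hγ.succ_lt hα)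
  have hβγ := Ordinal.toZFSet_mem_toZFSet_iff.1 (hD hβD)
  have := hU.neBot
  obtain ⟨σ, hσ, hσβ⟩ := (h'.and (hU.eventually_mem (hγ.succ_lt hβγ))).exists
  exact hσ _ hβD _ hσβ (Ordinal.toZFSet_mem_toZFSet_iff.2 (Order.succ_le_iff.1 hβ))
    (Ordinal.toZFSet_mem_toZFSet_iff.2 (Order.lt_succ β))

/-- A family of pairwise non-interleaved bounded sets of ordinals whose suprema are limit points of
`D` has at most as many members as `D`: send a set to the least element of `D` above it. -/
theorem card_le_of_limit_points {D Q : ZFSet.{u}} (hD : D ⊆ γ.toZFSet)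
    (hDcof : ∀ α < γ, ∃ β ≥ α, β.toZFSet ∈ D) (hQγ : ∀ τ ∈ Q, τ ⊆ γ.toZFSet)
    (hbdd : ∀ τ ∈ Q, ∃ β < γ, ∀ x ∈ τ, x ∈ β.toZFSet)
    (hlim : ∀ τ ∈ Q, ∀ x ∈ τ, ∃ d ∈ D, ∃ y ∈ τ, x ∈ d ∧ d ∈ y)
    (hQ : ∀ σ ∈ Q, ∀ τ ∈ Q, Interleaved σ τ → σ = τ) : Q.card ≤ D.card := by
  refine card_le_of_rel
    (fun τ d => (∀ x ∈ τ, x ∈ d) ∧ ∀ e ∈ D, (∀ x ∈ τ, x ∈ e) → e ∉ d) ?_ ?_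
  · intro τ hτ
    obtain ⟨β, hβ, hτβ⟩ := hbdd τ hτ
    obtain ⟨ξ, hξ, hξD⟩ := hDcof β hβ
    obtain ⟨d, ⟨hd, hτd⟩, hmin⟩ := ZFSet.mem_wf.has_min {d | d ∈ D ∧ ∀ x ∈ τ, x ∈ d}
      ⟨ξ.toZFSet, hξD, fun x hx => Ordinal.toZFSet_monotone hξ (hτβ x hx)⟩
    exact ⟨d, hd, hτd, fun e he hτe => hmin e ⟨he, hτe⟩⟩
  · have key : ∀ σ ∈ Q, ∀ τ ∈ Q, ∀ d ∈ D, (∀ y ∈ τ, y ∈ d) →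
        (∀ e ∈ D, (∀ x ∈ τ, x ∈ e) → e ∉ d) → (∀ x ∈ σ, x ∈ d) → ∀ x ∈ σ, ∃ y ∈ τ, x ∈ y := by
      intro σ hσ τ hτ d hd hτd hmin hσd x hx
      by_contra! hcon
      obtain ⟨e, he, z, hz, hxe, hez⟩ := hlim σ hσ x hx
      -- `τ` lies below `e`, and `e` is an element of `D` below the least one
      refine hmin e he (fun y hy => ?_) (isTransitive_of_mem_subset hD hd _ (hσd z hz) hez)
      obtain ⟨ξ, -, rfl⟩ := Ordinal.mem_toZFSet_iff.1 (hQγ σ hσ hx)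
      obtain ⟨η, -, rfl⟩ := Ordinal.mem_toZFSet_iff.1 (hQγ τ hτ hy)
      obtain ⟨ε, -, rfl⟩ := Ordinal.mem_toZFSet_iff.1 (hD he)
      have := hcon _ hy
      rw [Ordinal.toZFSet_mem_toZFSet_iff] at *
      exact (not_lt.1 this).trans_lt hxe
    rintro σ hσ τ hτ d hd ⟨h1, h2⟩ ⟨h3, h4⟩
    exact hQ σ hσ τ hτ ⟨key σ hσ τ hτ d hd h3 h4 h1, key τ hτ σ hσ d hd h1 h2 h3⟩

/-- An inner model contains one interleaved representative for each element of `limitSets`. -/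
theorem exists_representatives [hN : IsInnerModel N] (δ : Cardinal.{u}) (γ : Ordinal.{u}) :
    ∃ c ∈ N, c ⊆ limitSets N δ γ ∧
      ∀ σ ∈ limitSets N δ γ, ∃! τ, τ ∈ c ∧ Interleaved σ τ := by
  refine exists_transversal (limitSets_mem_class γ) Interleaved ?_ ?_ ?_
  · intro σ hσ
    have := (mem_limitSets.1 hσ).2.2.2
    exact ⟨this, this⟩
  · intro σ _ τ _ h
    exact ⟨h.2, h.1⟩
  · intro ρ hρ σ _ τ hτ h1 h2
    constructor
    · intro x hx
      obtain ⟨y, hy, hxy⟩ := h1.1 x hx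
      obtain ⟨z, hz, hyz⟩ := h2.1 y hy
      exact ⟨z, hz, isTransitive_of_mem_subset (mem_limitSets.1 hτ).2.1 hz _ hyz hxy⟩
    · intro x hx
      obtain ⟨y, hy, hxy⟩ := h2.2 x hx
      obtain ⟨z, hz, hyz⟩ := h1.2 y hy
      exact ⟨z, hz, isTransitive_of_mem_subset (mem_limitSets.1 hρ).2.1 hz _ hyz hxy⟩

/-- The representative in `c` of `σ` meets the interval `[ξ, η)`. -/
def MeetsInterval (c ξ η σ : ZFSet.{u}) : Prop :=
  ∃ τ ∈ c, Interleaved σ τ ∧ ∃ x ∈ τ, x ∉ ξ ∧ x ∈ η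

/-- By normality, for every `ξ < γ` there is `η < γ` such that almost every `σ` has a
representative meeting `[ξ, η)`. -/
theorem exists_eventually_meetsInterval (hU : IsNormalFineMeasure δ γ U)
    (hγ : Order.IsSuccLimit γ) (hconc : ZFSet.sep (fun σ => σ ∈ N) (Pset δ γ) ∈ U)
    {c : ZFSet.{u}} (hc : ∀ σ ∈ limitSets N δ γ, ∃! τ, τ ∈ c ∧ Interleaved σ τ)
    {ξ : Ordinal.{u}} (hξ : ξ < γ) :
    ∃ η < γ, ∀ᶠ σ in hU.filter, MeetsInterval c ξ.toZFSet η.toZFSet σ := by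
  refine hU.exists_eventually (p := fun y σ => MeetsInterval c ξ.toZFSet y σ) ?_
  filter_upwards [eventually_mem_limitSets hU hγ hconc, hU.eventually_mem hξ] with σ hσ hξσ
  obtain ⟨τ, ⟨hτ, hστ⟩, -⟩ := hc σ hσ
  obtain ⟨x, hx, hξx⟩ := hστ.1 _ hξσ
  obtain ⟨y, hy, hxy⟩ := hστ.2 x hx
  exact ⟨y, hy, τ, hτ, hστ, x, hx, fun h => ZFSet.mem_asymm h hξx, hxy⟩

/-- The model contains an unbounded subset `E` of `γ` such that, for `ξ < η` with `η ∈ E`, the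
representative of almost every `σ` meets `[ξ, η')` for some `η' < η`. -/
theorem exists_unbounded_meetsInterval [hN : IsInnerModel N] (hU : IsNormalFineMeasure δ γ U)
    (hγ : Order.IsSuccLimit γ) (hcof : Cardinal.aleph0 < γ.cof)
    (hconc : ZFSet.sep (fun σ => σ ∈ N) (Pset δ γ) ∈ U)
    (hUN : ZFSet.sep (fun X => X ∈ N) U ∈ N) {c : ZFSet.{u}} (hcN : c ∈ N)
    (hc : ∀ σ ∈ limitSets N δ γ, ∃! τ, τ ∈ c ∧ Interleaved σ τ) :
    ∃ E ∈ N, E ⊆ γ.toZFSet ∧ (∀ β < γ, ∃ η ≥ β, η.toZFSet ∈ E) ∧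
      ∀ η : Ordinal.{u}, η.toZFSet ∈ E → ∀ ξ < η, ∃ η' < η,
        ∀ᶠ σ in hU.filter, MeetsInterval c ξ.toZFSet η'.toZFSet σ := by
  set W := ZFSet.sep (fun X => X ∈ N) U with hW
  have : Fact (W ∈ N) := ⟨hUN⟩
  have : Fact (c ∈ N) := ⟨hcN⟩
  have hWiff : ∀ ξ η : Ordinal.{u}, (∃ Y ∈ W, ∀ σ ∈ Y, MeetsInterval c ξ.toZFSet η.toZFSet σ) ↔
      ∀ᶠ σ in hU.filter, MeetsInterval c ξ.toZFSet η.toZFSet σ := by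
    intro ξ η
    constructor
    · rintro ⟨Y, hY, h⟩
      exact hU.eventually_of_forall_mem (ZFSet.mem_sep.1 hY).1 h
    · intro h
      have hdef : IsDefPred N (fun v : Fin 1 → N =>
          MeetsInterval c ξ.toZFSet η.toZFSet (v 0)) := by
        unfold MeetsInterval
        infer_instance
      refine ⟨_, ZFSet.mem_sep.2 ⟨?_, sep_mem_class (limitSets_mem_class (δ := δ) γ)
        (fun σ => MeetsInterval c ξ.toZFSet η.toZFSet σ)⟩, fun σ hσ => (ZFSet.mem_sep.1 hσ).2⟩
      refine hU.mem_of_superset _ (hU.eventually_iff.1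
        (h.and (eventually_mem_limitSets hU hγ hconc))) _ ?_ ?_
      · intro σ hσ
        obtain ⟨-, h1, h2⟩ := ZFSet.mem_sep.1 hσ
        exact ZFSet.mem_sep.2 ⟨h2, h1⟩
      · intro σ hσ
        exact (ZFSet.mem_sep.1 (ZFSet.mem_sep.1 hσ).1).1
  have hdef : IsDefPred N (fun v : Fin 1 → N => ∀ ξ ∈ (v 0 : ZFSet.{u}), ∃ η ∈ (v 0 : ZFSet.{u}),
      ∃ Y ∈ W, ∀ σ ∈ Y, MeetsInterval c ξ η σ) := by
    unfold MeetsInterval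
    infer_instance
  refine ⟨_, sep_mem_class (hN.ordinal_mem γ)
    (fun ζ => ∀ ξ ∈ ζ, ∃ η ∈ ζ, ∃ Y ∈ W, ∀ σ ∈ Y, MeetsInterval c ξ η σ),
    ZFSet.sep_subset, ?_, ?_⟩
  · intro β hβ
    have hex : ∀ ξ, ∃ η, ξ < γ → η < γ ∧
        ∀ᶠ σ in hU.filter, MeetsInterval c ξ.toZFSet η.toZFSet σ := by
      intro ξ
      by_cases hξ : ξ < γ
      · obtain ⟨η, hη, h⟩ := exists_eventually_meetsInterval hU hγ hconc hc hξ
        exact ⟨η, fun _ => ⟨hη, h⟩⟩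
      · exact ⟨0, fun h => (hξ h).elim⟩
    choose h hh using hex
    -- the limit of the iterates of `f` is closed under `h`; the second argument of the maximum
    -- makes every iterate strictly smaller than the limit
    let f : Ordinal.{u} → Ordinal.{u} := fun ξ => max (h ξ) (Order.succ ξ)
    have hnfp : Ordinal.nfp f β < γ := Ordinal.nfp_lt_ord hcof
      (fun i hi => max_lt (hh i hi).1 (hγ.succ_lt hi)) hβ
    refine ⟨Ordinal.nfp f β, Ordinal.le_nfp f β,
      ZFSet.mem_sep.2 ⟨Ordinal.toZFSet_mem_toZFSet_iff.2 hnfp, ?_⟩⟩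
    intro x hx
    obtain ⟨ξ, hξ, rfl⟩ := Ordinal.mem_toZFSet_iff.1 hx
    obtain ⟨n, hn⟩ := Ordinal.lt_nfp_iff.1 hξ
    set ζ := f^[n] β with hζ
    have hf : f ζ < Ordinal.nfp f β := by
      refine Ordinal.lt_nfp_iff.2 ⟨n + 2, ?_⟩
      rw [Function.iterate_succ_apply', Function.iterate_succ_apply', ← hζ]
      exact (Order.lt_succ _).trans_le (le_max_right _ _)
    have hζγ : ζ < γ :=
      ((Order.lt_succ _).trans_le (le_max_right (h ζ) _)).trans (hf.trans hnfp)
    refine ⟨_, Ordinal.toZFSet_mem_toZFSet_iff.2 hf, (hWiff ξ (f ζ)).2 ?_⟩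
    filter_upwards [(hh ζ hζγ).2] with σ hσ
    obtain ⟨τ, hτ, hστ, x, hx, hxζ, hxh⟩ := hσ
    exact ⟨τ, hτ, hστ, x, hx, fun h => hxζ (Ordinal.toZFSet_monotone hn.le h),
      Ordinal.toZFSet_monotone (le_max_left _ _) hxh⟩
  · intro η hη ξ hξ
    obtain ⟨y, hy, h⟩ := (ZFSet.mem_sep.1 hη).2 _ (Ordinal.toZFSet_mem_toZFSet_iff.2 hξ)
    obtain ⟨η', hη', rfl⟩ := Ordinal.mem_toZFSet_iff.1 hy
    exact ⟨η', hη', (hWiff ξ η').1 h⟩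

/-- The representatives whose suprema are limit points of a cofinal set `D` of size `cf γ` meet
every interval between consecutive elements of an unbounded set `E` in the model; there are at most
`cf γ` of them, each of size less than `δ ≤ cf γ`, whereas `E` has size `|γ|`. -/
theorem card_eq_cof_of_regularInClass (hN : IsWeakExtenderModel N δ) (hδ : δ.ord < γ)
    (hreg : RegularInClass N γ) : γ.card = γ.cof := by
  have hinner := hN.isInnerModel
  obtain ⟨U, hU, hconc, hUN⟩ := hN.measures γ hδ
  have hlim := hreg.isSuccLimit
  have hδcof := le_cof_of_regularInClass hU hreg hδ hconc
  have hω := aleph0_lt_of_isNormalFineMeasure hU hlim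
  obtain ⟨D, hD, hDcard, hDcof⟩ := exists_cofinal_set γ
  obtain ⟨c, hcN, hcP, hc⟩ := exists_representatives (N := N) δ γ
  obtain ⟨E, hEN, hEγ, hEunb, hE⟩ := exists_unbounded_meetsInterval hU hlim
    (hω.trans_le hδcof) hconc hUN hcN hc
  set Q := ZFSet.sep (fun τ => ∀ x ∈ τ, ∃ d ∈ D, ∃ y ∈ τ, x ∈ d ∧ d ∈ y) c with hQ
  have hQP : ∀ τ ∈ Q, τ ∈ limitSets N δ γ := fun τ hτ => hcP (ZFSet.mem_sep.1 hτ).1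
  have hQD : Q.card ≤ D.card := by
    refine card_le_of_limit_points hD hDcof (fun τ hτ => (mem_limitSets.1 (hQP τ hτ)).2.1)
      (fun τ hτ => bounded_of_mem_limitSets hreg hδ (hQP τ hτ))
      (fun τ hτ => (ZFSet.mem_sep.1 hτ).2) ?_
    intro σ hσ τ hτ h
    have hnm := (mem_limitSets.1 (hQP σ hσ)).2.2.2
    exact (hc σ (hQP σ hσ)).unique ⟨(ZFSet.mem_sep.1 hσ).1, hnm, hnm⟩
      ⟨(ZFSet.mem_sep.1 hτ).1, h⟩
  have hEQ : E.card ≤ (ZFSet.sUnion Q).card := by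
    -- relate `ξ ∈ E` to the points between `ξ` and the next element of `E`
    refine card_le_of_rel (fun ξ x => x ∉ ξ ∧ ∀ η ∈ E, ξ ∈ η → x ∈ η) ?_ ?_
    · intro x hx
      obtain ⟨ξ, hξ, rfl⟩ := Ordinal.mem_toZFSet_iff.1 (hEγ hx)
      obtain ⟨ζ, hζ, hζE⟩ := hEunb _ (hlim.succ_lt hξ)
      obtain ⟨η, ⟨hξη, hηE⟩, hmin⟩ := wellFounded_lt.has_min
        {η : Ordinal.{u} | ξ < η ∧ η.toZFSet ∈ E} ⟨ζ, Order.succ_le_iff.1 hζ, hζE⟩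
      obtain ⟨η', hη', hev⟩ := hE η hηE ξ hξη
      have := hU.neBot
      obtain ⟨σ, ⟨τ, hτ, hστ, x, hx, hxξ, hxη⟩, hσ⟩ :=
        (hev.and (eventually_limit_point hU hlim hD hDcof)).exists
      refine ⟨x, ZFSet.mem_sUnion.2 ⟨τ, ZFSet.mem_sep.2 ⟨hτ, ?_⟩, hx⟩, hxξ, ?_⟩
      -- `τ` is interleaved with `σ`, so its supremum is a limit point of `D`, too
      · intro y hy
        obtain ⟨z, hz, hyz⟩ := hστ.2 y hy
        obtain ⟨d, hd, w, hw, hzd, hdw⟩ := hσ z hz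
        obtain ⟨t, ht, hwt⟩ := hστ.1 w hw
        exact ⟨d, hd, t, ht, isTransitive_of_mem_subset hD hd _ hzd hyz,
          isTransitive_of_mem_subset (mem_limitSets.1 (hcP hτ)).2.1 ht _ hwt hdw⟩
      · intro y hy hξy
        obtain ⟨ε, -, rfl⟩ := Ordinal.mem_toZFSet_iff.1 (hEγ hy)
        have hηε : η ≤ ε := not_lt.1 (hmin ε ⟨Ordinal.toZFSet_mem_toZFSet_iff.1 hξy, hy⟩)
        exact Ordinal.toZFSet_monotone (hη'.le.trans hηε) hxη
    · rintro x hx y hy z - ⟨h1, h2⟩ ⟨h3, h4⟩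
      obtain ⟨ξ, -, rfl⟩ := Ordinal.mem_toZFSet_iff.1 (hEγ hx)
      obtain ⟨η, -, rfl⟩ := Ordinal.mem_toZFSet_iff.1 (hEγ hy)
      rcases lt_trichotomy ξ η with h | h | h
      · exact (h3 (h2 _ hy (Ordinal.toZFSet_mem_toZFSet_iff.2 h))).elim
      · rw [h]
      · exact (h1 (h4 _ hx (Ordinal.toZFSet_mem_toZFSet_iff.2 h))).elim
  refine le_antisymm ?_ (Ordinal.cof_le_card γ)
  calc γ.card ≤ E.card := card_le_card_of_unbounded hreg hEN hEγ hEunb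
    _ ≤ (ZFSet.sUnion Q).card := hEQ
    _ ≤ Q.card * δ := card_sUnion_le fun τ hτ => (mem_limitSets.1 (hQP τ hτ)).2.2.1.le
    _ ≤ γ.cof * γ.cof := mul_le_mul' (hQD.trans hDcard) hδcof
    _ = γ.cof := Cardinal.mul_eq_self (hω.le.trans hδcof)

end Regular

/-! ### A pairing function in the model -/

section Pairing

/-- A strictly increasing function from pairs of ordinals with Gödel's well-ordering to the
ordinals: for `M = max a b + 1` the value is `M³ + (M a + b)`, where `M a + b < M²`. It
need not be the rank function, but it bounds the rank function and maps `γ × γ` into `γ`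
for infinite cardinals `γ`. -/
noncomputable def goedelBound (a b : Ordinal.{u}) : Ordinal.{u} :=
  (max a b + 1) * (max a b + 1) * (max a b + 1) + ((max a b + 1) * a + b)

theorem goedelBound_lt_of_max_lt {a b c d : Ordinal.{u}} (h : max a b < max c d) :
    goedelBound a b < goedelBound c d := by
  have hM : max a b + 1 ≤ max c d := Order.add_one_le_of_lt h
  have ha : a + 1 ≤ max a b + 1 := add_le_add_left (le_max_left a b) 1
  have hb : b < max a b + 1 := Order.lt_add_one_iff.2 (le_max_right a b)
  rw [goedelBound, goedelBound]
  generalize max a b + 1 = M at *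
  generalize max c d = K at *
  have h1 : M * a + b < M * M :=
    calc M * a + b < M * a + M := by gcongr
      _ = M * (a + 1) := (mul_add_one M a).symm
      _ ≤ M * M := by gcongr
  have hK : M ≤ K + 1 := hM.trans (Order.le_succ K)
  have hK' : M + 1 ≤ K + 1 := by gcongr
  calc M * M * M + (M * a + b) < M * M * M + M * M := by gcongr
    _ = M * M * (M + 1) := (mul_add_one _ M).symm
    _ ≤ (K + 1) * (K + 1) * (K + 1) := by gcongr
    _ ≤ (K + 1) * (K + 1) * (K + 1) + ((K + 1) * c + d) := le_self_add

theorem goedelBound_lt_of_lt {a b c d : Ordinal.{u}} (h : max a b = max c d) (hac : a < c) :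
    goedelBound a b < goedelBound c d := by
  have hb : b < max a b + 1 := Order.lt_add_one_iff.2 (le_max_right a b)
  rw [goedelBound, goedelBound, ← h]
  generalize max a b + 1 = M at *
  gcongr M * M * M + ?_
  calc M * a + b < M * a + M := by gcongr
    _ = M * (a + 1) := (mul_add_one M a).symm
    _ ≤ M * c := by gcongr; exact Order.add_one_le_of_lt hac
    _ ≤ M * c + d := le_self_add

theorem goedelBound_lt_of_eq {a b d : Ordinal.{u}} (h : max a b = max a d) (hbd : b < d) :
    goedelBound a b < goedelBound a d := by
  rw [goedelBound, goedelBound, ← h]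
  gcongr

theorem goedelBound_lt_ord {γ : Cardinal.{u}} (hγ : Cardinal.aleph0 ≤ γ) {a b : Ordinal.{u}}
    (ha : a < γ.ord) (hb : b < γ.ord) : goedelBound a b < γ.ord := by
  have hM : max a b + 1 < γ.ord := (Cardinal.isSuccLimit_ord hγ).succ_lt (max_lt ha hb)
  have hmul := Ordinal.isPrincipal_mul_ord hγ
  have hadd := Ordinal.isPrincipal_add_ord hγ
  exact hadd (hmul (hmul hM hM) hM) (hadd (hmul hM ha) hb)

/-- Gödel's well-ordering of the pairs of elements of the ordinal `Γ`: compare the maxima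
first, then lexicographically. The definition uses only bounded quantifiers and membership. -/
def GoedelLT (Γ p q : ZFSet.{u}) : Prop :=
  ∃ a ∈ Γ, ∃ b ∈ Γ, ∃ c ∈ Γ, ∃ d ∈ Γ, p = ZFSet.pair a b ∧ q = ZFSet.pair c d ∧
    (((a ∈ c ∨ a ∈ d) ∧ (b ∈ c ∨ b ∈ d)) ∨
      (¬ ((c ∈ a ∨ c ∈ b) ∧ (d ∈ a ∨ d ∈ b)) ∧ (a ∈ c ∨ (a = c ∧ b ∈ d))))

theorem goedelLT_iff {γ a b c d : Ordinal.{u}} (ha : a < γ) (hb : b < γ) (hc : c < γ)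
    (hd : d < γ) :
    GoedelLT γ.toZFSet (ZFSet.pair a.toZFSet b.toZFSet) (ZFSet.pair c.toZFSet d.toZFSet) ↔
      max a b < max c d ∨ (max a b ≤ max c d ∧ (a < c ∨ (a = c ∧ b < d))) := by
  have hmem : ∀ {x y : Ordinal.{u}}, x.toZFSet ∈ y.toZFSet ↔ x < y :=
    Ordinal.toZFSet_mem_toZFSet_iff
  have hinj : ∀ {x y : Ordinal.{u}}, x.toZFSet = y.toZFSet ↔ x = y :=
    Ordinal.toZFSet_injective.eq_iff
  have hmax : ∀ a b c d : Ordinal.{u},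
      max a b < max c d ↔ (a < c ∨ a < d) ∧ (b < c ∨ b < d) := fun a b c d => by
    rw [max_lt_iff, lt_max_iff, lt_max_iff]
  rw [← not_lt (a := max c d), hmax, hmax]
  constructor
  · rintro ⟨a', ha', b', hb', c', hc', d', hd', h1, h2, h⟩
    obtain ⟨rfl, rfl⟩ := ZFSet.pair_inj.1 h1
    obtain ⟨rfl, rfl⟩ := ZFSet.pair_inj.1 h2
    simpa only [hmem, hinj] using h
  · intro h
    refine ⟨_, hmem.2 ha, _, hmem.2 hb, _, hmem.2 hc, _, hmem.2 hd, rfl, rfl, ?_⟩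
    simpa only [hmem, hinj] using h

/-- An inner model contains an injection of `γ × γ` into `γ`, for every infinite cardinal `γ`
of `V`: the rank function of Gödel's well-ordering. -/
theorem exists_pairing {N : Set ZFSet.{u}} [hN : IsInnerModel N] {γ : Cardinal.{u}}
    (hγ : Cardinal.aleph0 ≤ γ) :
    ∃ e ∈ N, (∀ i ∈ γ.ord.toZFSet, ∀ j ∈ γ.ord.toZFSet, ∃ x ∈ γ.ord.toZFSet,
        ZFSet.pair (ZFSet.pair i j) x ∈ e) ∧
      ∀ p q x, ZFSet.pair p x ∈ e → ZFSet.pair q x ∈ e → p = q := by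
  classical
  set Γ := γ.ord.toZFSet with hΓ
  have hdec : ∀ p ∈ ZFSet.prod Γ Γ, ∃ ab : Ordinal.{u} × Ordinal.{u},
      ab.1 < γ.ord ∧ ab.2 < γ.ord ∧ p = ZFSet.pair ab.1.toZFSet ab.2.toZFSet := by
    intro p hp
    obtain ⟨x, hx, y, hy, rfl⟩ := ZFSet.mem_prod.1 hp
    obtain ⟨a, ha, rfl⟩ := Ordinal.mem_toZFSet_iff.1 hx
    obtain ⟨b, hb, rfl⟩ := Ordinal.mem_toZFSet_iff.1 hy
    exact ⟨(a, b), ha, hb, rfl⟩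
  choose! co hco1 hco2 hco using hdec
  let g : ZFSet.{u} → Ordinal.{u} := fun p => goedelBound (co p).1 (co p).2
  have hlt : ∀ p ∈ ZFSet.prod Γ Γ, ∀ q ∈ ZFSet.prod Γ Γ, GoedelLT Γ p q ↔
      max (co p).1 (co p).2 < max (co q).1 (co q).2 ∨
        (max (co p).1 (co p).2 ≤ max (co q).1 (co q).2 ∧
          ((co p).1 < (co q).1 ∨ ((co p).1 = (co q).1 ∧ (co p).2 < (co q).2))) := by
    intro p hp q hq
    conv_lhs => rw [hco p hp, hco q hq]
    exact goedelLT_iff (hco1 p hp) (hco2 p hp) (hco1 q hq) (hco2 q hq)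
  have hg : ∀ p ∈ ZFSet.prod Γ Γ, ∀ q ∈ ZFSet.prod Γ Γ, GoedelLT Γ p q → g p < g q := by
    intro p hp q hq h
    rcases (hlt p hp q hq).1 h with h | ⟨h1, h2⟩
    · exact goedelBound_lt_of_max_lt h
    rcases h1.lt_or_eq with h1 | h1
    · exact goedelBound_lt_of_max_lt h1
    rcases h2 with h2 | ⟨h2, h3⟩
    · exact goedelBound_lt_of_lt h1 h2
    · simp only [g]
      rw [← h2] at h1 ⊢
      exact goedelBound_lt_of_eq h1 h3
  have htri : ∀ p ∈ ZFSet.prod Γ Γ, ∀ q ∈ ZFSet.prod Γ Γ,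
      GoedelLT Γ p q ∨ p = q ∨ GoedelLT Γ q p := by
    intro p hp q hq
    rw [hlt p hp q hq, hlt q hq p hp]
    have heq : (co p).1 = (co q).1 → (co p).2 = (co q).2 → p = q := fun h1 h2 => by
      rw [hco p hp, hco q hq, h1, h2]
    rcases lt_trichotomy (max (co p).1 (co p).2) (max (co q).1 (co q).2) with h | h | h
    · exact .inl (.inl h)
    · rcases lt_trichotomy (co p).1 (co q).1 with h1 | h1 | h1
      · exact .inl (.inr ⟨h.le, .inl h1⟩)
      · rcases lt_trichotomy (co p).2 (co q).2 with h2 | h2 | h2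
        · exact .inl (.inr ⟨h.le, .inr ⟨h1, h2⟩⟩)
        · exact .inr (.inl (heq h1 h2))
        · exact .inr (.inr (.inr ⟨h.ge, .inr ⟨h1.symm, h2⟩⟩))
      · exact .inr (.inr (.inr ⟨h.ge, .inl h1⟩))
    · exact .inr (.inr (.inl h))
  obtain ⟨ρ, hρ⟩ := exists_rank_function (ZFSet.prod Γ Γ) (GoedelLT Γ)
    (Subrelation.wf (fun {p q} h => hg p p.2 q q.2 h)
      (InvImage.wf (fun p : {x // x ∈ ZFSet.prod Γ Γ} => g p) wellFounded_lt))
  have hmono : ∀ p ∈ ZFSet.prod Γ Γ, ∀ q ∈ ZFSet.prod Γ Γ, GoedelLT Γ p q → ρ p < ρ q :=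
    fun p hp q hq h => (hρ q hq _).2 ⟨p, hp, h, le_rfl⟩
  have hle : ∀ α, ∀ p ∈ ZFSet.prod Γ Γ, ρ p = α → ρ p ≤ g p := by
    intro α
    induction α using WellFoundedLT.induction with
    | _ α ih =>
      rintro p hp rfl
      by_contra! h
      obtain ⟨q, hq, hqp, h⟩ := (hρ p hp _).1 h
      exact (h.trans (ih _ (hmono q hq p hp hqp) q hq rfl)).not_gt (hg q hq p hp hqp)
  have hdef : IsDefPred N (fun v : Fin 2 → N => GoedelLT Γ (v 0) (v 1)) := by
    unfold GoedelLT
    infer_instance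
  obtain ⟨e, he, hem⟩ := exists_rank_graph
    (prod_mem_class (hN.ordinal_mem γ.ord) (hN.ordinal_mem γ.ord)) (GoedelLT Γ) ρ hρ
  refine ⟨e, he, fun i hi j hj => ?_, fun p q x hp hq => ?_⟩
  · have hp : ZFSet.pair i j ∈ ZFSet.prod Γ Γ := ZFSet.pair_mem_prod.2 ⟨hi, hj⟩
    refine ⟨_, Ordinal.toZFSet_mem_toZFSet_iff.2 ?_, (hem _ _).2 ⟨hp, rfl⟩⟩
    exact (hle _ _ hp rfl).trans_lt (goedelBound_lt_ord hγ (hco1 _ hp) (hco2 _ hp))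
  · obtain ⟨hpA, rfl⟩ := (hem _ _).1 hp
    obtain ⟨hqA, h⟩ := (hem _ _).1 hq
    have h := Ordinal.toZFSet_injective h
    rcases htri p hpA q hqA with h1 | h1 | h1
    · exact absurd h (hmono p hpA q hqA h1).ne
    · exact h1
    · exact absurd h (hmono q hqA p hpA h1).ne'

end Pairing

/-! ### Successor cardinals are regular in the model -/

section Successor

variable {N : Set ZFSet.{u}} [hN : IsInnerModel N]

/-- Infinite cardinals of `V` are infinite cardinals of every inner model. -/
theorem isInfiniteCardinalIn_ord {γ : Cardinal.{u}} (hγ : Cardinal.aleph0 ≤ γ) :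
    IsInfiniteCardinalIn (memOn N) ⟨γ.ord.toZFSet, hN.ordinal_mem _⟩ := by
  have hlim := Cardinal.isSuccLimit_ord hγ
  refine ⟨⟨isOrdinalIn_iff.2 (ZFSet.isOrdinal_toZFSet _), ?_⟩, ?_, ?_⟩
  · rintro ⟨a, haN⟩ ha ⟨⟨f, hf⟩, ⟨hfun, htot⟩, hsurj⟩
    obtain ⟨α, hα, rfl⟩ := Ordinal.mem_toZFSet_iff.1 (show a ∈ γ.ord.toZFSet from ha)
    refine (Cardinal.lt_ord.1 hα).not_ge ?_
    have hle : γ.ord.toZFSet.card ≤ α.toZFSet.card := by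
      refine card_le_of_rel (fun y x => ZFSet.pair x y ∈ f) ?_ ?_
      · intro y hy
        obtain ⟨x, hx, hxy⟩ := hsurj ⟨y, hN.transitive _ (hN.ordinal_mem _) _ hy⟩ hy
        exact ⟨x, hx, mapsTo_iff.1 hxy⟩
      · intro y hy z hz x hx hxy hxz
        have hN' : ∀ w ∈ γ.ord.toZFSet, w ∈ N := fun w => hN.transitive _ (hN.ordinal_mem _) w
        have := (htot ⟨x, hN.transitive _ haN _ hx⟩ hx).unique
          (y₁ := ⟨y, hN' y hy⟩) (y₂ := ⟨z, hN' z hz⟩) (mapsTo_iff.2 hxy) (mapsTo_iff.2 hxz)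
        exact congrArg Subtype.val this
    simpa using hle
  · exact ⟨⟨_, hN.ordinal_mem 0⟩, Ordinal.toZFSet_mem_toZFSet_iff.2 hlim.bot_lt⟩
  · rintro ⟨x, hxN⟩ hx
    obtain ⟨α, hα, rfl⟩ := Ordinal.mem_toZFSet_iff.1 (show x ∈ γ.ord.toZFSet from hx)
    exact ⟨⟨_, hN.ordinal_mem (Order.succ α)⟩,
      Ordinal.toZFSet_mem_toZFSet_iff.2 (hlim.succ_lt hα),
      Ordinal.toZFSet_mem_toZFSet_iff.2 (Order.lt_succ α)⟩

/-- Cardinals of an inner model above `ω` are limit ordinals: the map sending `0` to `β`, `n + 1` to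
`n`, and every infinite ordinal to itself maps `β` onto `β + 1`. -/
theorem isSuccLimit_of_isCardinalIn {κ : Ordinal.{u}} {h : κ.toZFSet ∈ N}
    (hκ : IsCardinalIn (memOn N) ⟨κ.toZFSet, h⟩) (hω : Ordinal.omega0 < κ) :
    Order.IsSuccLimit κ := by
  rw [Ordinal.isSuccLimit_iff, Order.isSuccPrelimit_iff_succ_lt]
  refine ⟨(bot_le.trans_lt hω).ne', fun β hβ => ?_⟩
  by_contra hcon
  obtain rfl : κ = Order.succ β := le_antisymm (not_lt.1 hcon) (Order.succ_le_of_lt hβ)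
  have hωβ : Ordinal.omega0 ≤ β := Order.lt_succ_iff.1 hω
  have hmem : ∀ {x y : Ordinal.{u}}, x.toZFSet ∈ y.toZFSet ↔ x < y :=
    Ordinal.toZFSet_mem_toZFSet_iff
  obtain ⟨ξ, hξ, hno⟩ := not_covered_of_isCardinalIn hκ hβ
    (fun x y => (x = (0 : Ordinal.{u}).toZFSet ∧ y = β.toZFSet) ∨
      (x ∈ Ordinal.omega0.toZFSet ∧ y ∈ x ∧ ∀ z ∈ x, z = y ∨ z ∈ y) ∨
      (x ∉ Ordinal.omega0.toZFSet ∧ y = x)) (by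
    rintro x - y - z - (⟨rfl, rfl⟩ | ⟨h1, h2, h3⟩ | ⟨h1, rfl⟩)
      (⟨h4, rfl⟩ | ⟨h4, h5, h6⟩ | ⟨h4, rfl⟩)
    · rfl
    · simp at h5
    · exact (h4 (hmem.2 Ordinal.omega0_pos)).elim
    · subst h4
      simp at h2
    · rcases h3 z h5 with h | h
      · exact h.symm
      · rcases h6 y h2 with h' | h'
        · exact h'
        · exact (ZFSet.mem_asymm h h').elim
    · exact (h4 h1).elim
    · subst h4
      exact (h1 (hmem.2 Ordinal.omega0_pos)).elim
    · exact (h1 h4).elim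
    · rfl)
  rcases (Order.lt_succ_iff.1 hξ).eq_or_lt with rfl | hξ
  · exact hno _ (hmem.2 (Ordinal.omega0_pos.trans_le hωβ)) (.inl ⟨rfl, rfl⟩)
  · by_cases hfin : ξ < Ordinal.omega0
    · have hs : Order.succ ξ < Ordinal.omega0 := Ordinal.isSuccLimit_omega0.succ_lt hfin
      refine hno _ (hmem.2 (hs.trans_le hωβ))
        (.inr (.inl ⟨hmem.2 hs, hmem.2 (Order.lt_succ ξ), ?_⟩))
      intro z hz
      obtain ⟨ζ, hζ, rfl⟩ := Ordinal.mem_toZFSet_iff.1 hz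
      rcases (Order.lt_succ_iff.1 hζ).eq_or_lt with rfl | h
      · exact .inl rfl
      · exact .inr (hmem.2 h)
    · exact hno _ (hmem.2 hξ) (.inr (.inr ⟨fun h => hfin (hmem.1 h), rfl⟩))

/-- `g` restricts to a partial map from `a`, with values in `t`, whose range includes `ξ`. -/
def Covers (a t g ξ : ZFSet.{u}) : Prop :=
  (∀ x ∈ a, ∀ y ∈ t, ∀ z ∈ t, ZFSet.pair x y ∈ g → ZFSet.pair x z ∈ g → y = z) ∧
    ∀ y ∈ ξ, ∃ x ∈ a, ZFSet.pair x y ∈ g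

/-- If there are no cardinals of the model strictly between `γ` and `t`, then the model maps `γ`
onto every ordinal below `t`. -/
theorem exists_covers {γ t : Ordinal.{u}}
    (hmin : ∀ ξ, γ < ξ → ξ < t → ¬ IsCardinalIn (memOn N) ⟨ξ.toZFSet, hN.ordinal_mem ξ⟩)
    (ξ : Ordinal.{u}) (hξ : ξ < t) :
    ∃ g ∈ N, (∀ p ∈ g, p ∈ ZFSet.prod γ.toZFSet t.toZFSet) ∧
      Covers γ.toZFSet t.toZFSet g ξ.toZFSet := by
  have hmem : ∀ {x y : Ordinal.{u}}, x.toZFSet ∈ y.toZFSet ↔ x < y :=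
    Ordinal.toZFSet_mem_toZFSet_iff
  have hprod : ∀ {g : ZFSet.{u}}, (∀ p ∈ g, ∃ x ∈ γ.toZFSet, ∃ y ∈ t.toZFSet,
      p = ZFSet.pair x y) → ∀ p ∈ g, p ∈ ZFSet.prod γ.toZFSet t.toZFSet :=
    fun h p hp => ZFSet.mem_prod.2 (h p hp)
  induction ξ using WellFoundedLT.induction with
  | _ ξ ih =>
    rcases le_or_gt ξ γ with h | h
    · obtain ⟨g, hg, hgp, hgm⟩ := exists_graph_mem_class (hN.ordinal_mem γ) (hN.ordinal_mem t)
        (fun x y => x = y)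
      refine ⟨g, hg, hprod hgp, ?_, ?_⟩
      · intro x _ y _ z _ hy hz
        exact ((hgm _ _).1 hy).2.2.symm.trans ((hgm _ _).1 hz).2.2
      · intro y hy
        have hyγ := Ordinal.toZFSet_monotone h hy
        exact ⟨y, hyγ, (hgm _ _).2 ⟨hyγ, Ordinal.toZFSet_monotone hξ.le hy, rfl⟩⟩
    · have hnot := hmin ξ h hξ
      simp only [IsCardinalIn, isOrdinalIn_iff, ZFSet.isOrdinal_toZFSet, true_and, not_forall,
        not_not] at hnot
      obtain ⟨⟨a, haN⟩, ha, ⟨f, hf⟩, ⟨-, hftot⟩, hfsurj⟩ := hnot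
      obtain ⟨α, hα, rfl⟩ := Ordinal.mem_toZFSet_iff.1 (show a ∈ ξ.toZFSet from ha)
      obtain ⟨g', hg', -, hg'fun, hg'cov⟩ := ih α hα (hα.trans hξ)
      have : Fact (g' ∈ N) := ⟨hg'⟩
      have : Fact (f ∈ N) := ⟨hf⟩
      obtain ⟨g, hg, hgp, hgm⟩ := exists_graph_mem_class (hN.ordinal_mem γ) (hN.ordinal_mem t)
        (fun x y => ∃ z ∈ α.toZFSet, ZFSet.pair x z ∈ g' ∧ ZFSet.pair z y ∈ f)
      have htN : ∀ w ∈ t.toZFSet, w ∈ N := fun w => hN.transitive _ (hN.ordinal_mem _) w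
      have hαt := Ordinal.toZFSet_monotone (hα.trans hξ).le
      refine ⟨g, hg, hprod hgp, ?_, ?_⟩
      · intro x hx y hy y' hy' h1 h2
        obtain ⟨-, -, z, hz, hxz, hzy⟩ := (hgm _ _).1 h1
        obtain ⟨-, -, z', hz', hxz', hzy'⟩ := (hgm _ _).1 h2
        obtain rfl := hg'fun x hx z (hαt hz) z' (hαt hz') hxz hxz'
        have := (hftot ⟨z, hN.transitive _ haN _ hz⟩ hz).unique
          (y₁ := ⟨y, htN y hy⟩) (y₂ := ⟨y', htN y' hy'⟩) (mapsTo_iff.2 hzy) (mapsTo_iff.2 hzy')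
        exact congrArg Subtype.val this
      · intro y hy
        have hyt := Ordinal.toZFSet_monotone hξ.le hy
        obtain ⟨⟨z, hzN⟩, hz, hzy⟩ := hfsurj ⟨y, htN y hyt⟩ hy
        obtain ⟨x, hx, hxz⟩ := hg'cov z hz
        exact ⟨x, hx, (hgm _ _).2 ⟨hx, hyt, z, hz, hxz, mapsTo_iff.1 hzy⟩⟩

/-- The model chooses, for every ordinal `ξ` below `t`, a map from `γ` onto `ξ`. -/
theorem exists_covering_family {γ t : Ordinal.{u}}
    (hmin : ∀ ξ, γ < ξ → ξ < t → ¬ IsCardinalIn (memOn N) ⟨ξ.toZFSet, hN.ordinal_mem ξ⟩) :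
    ∃ c ∈ N, (∀ ξ ∈ t.toZFSet, ∃ g ∈ N, ZFSet.pair ξ g ∈ c) ∧
      (∀ ξ g, ZFSet.pair ξ g ∈ c → Covers γ.toZFSet t.toZFSet g ξ) ∧
      ∀ ξ g h, ZFSet.pair ξ g ∈ c → ZFSet.pair ξ h ∈ c → g = h := by
  have hdef : IsDefPred N (fun v : Fin 1 → N => ∃ ξ ∈ t.toZFSet, ∃ g ∈ N,
      (v 0 : ZFSet.{u}) = ZFSet.pair ξ g ∧ Covers γ.toZFSet t.toZFSet g ξ) := by
    unfold Covers
    infer_instance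
  have hP := sep_mem_class (prod_mem_class (hN.ordinal_mem t)
      (powersetIn_mem_class (prod_mem_class (hN.ordinal_mem γ) (hN.ordinal_mem t))))
    (fun p => ∃ ξ ∈ t.toZFSet, ∃ g ∈ N, p = ZFSet.pair ξ g ∧ Covers γ.toZFSet t.toZFSet g ξ)
  set P := ZFSet.sep (fun p => ∃ ξ ∈ t.toZFSet, ∃ g ∈ N, p = ZFSet.pair ξ g ∧
    Covers γ.toZFSet t.toZFSet g ξ)
    (ZFSet.prod t.toZFSet (powersetIn N (ZFSet.prod γ.toZFSet t.toZFSet))) with hPdef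
  obtain ⟨c, hc, hcP, hcuniq⟩ := exists_transversal hP
    (fun p q => ∃ ξ ∈ t.toZFSet, ∃ g ∈ N, ∃ h ∈ N, p = ZFSet.pair ξ g ∧ q = ZFSet.pair ξ h) (by
      intro p hp
      obtain ⟨-, ξ, hξ, g, hg, rfl, -⟩ := ZFSet.mem_sep.1 hp
      exact ⟨ξ, hξ, g, hg, g, hg, rfl, rfl⟩) (by
      rintro p - q - ⟨ξ, hξ, g, hg, h, hh, h1, h2⟩
      exact ⟨ξ, hξ, h, hh, g, hg, h2, h1⟩) (by
      rintro p - q - r - ⟨ξ, hξ, g, hg, h, hh, h1, h2⟩ ⟨ξ', hξ', g', hg', h', hh', h1', h2'⟩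
      obtain ⟨rfl, rfl⟩ := ZFSet.pair_inj.1 (h2.symm.trans h1')
      exact ⟨ξ, hξ, g, hg, h', hh', h1, h2'⟩)
  have hcm : ∀ ξ g, ZFSet.pair ξ g ∈ c →
      ξ ∈ t.toZFSet ∧ g ∈ N ∧ Covers γ.toZFSet t.toZFSet g ξ := by
    intro ξ g h
    obtain ⟨-, ξ', hξ', g', hg', heq, hcov⟩ := ZFSet.mem_sep.1 (hcP h)
    obtain ⟨rfl, rfl⟩ := ZFSet.pair_inj.1 heq
    exact ⟨hξ', hg', hcov⟩
  refine ⟨c, hc, fun x hx => ?_, fun ξ g h => (hcm ξ g h).2.2, fun ξ g h hg hh => ?_⟩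
  · obtain ⟨ξ, hξ, rfl⟩ := Ordinal.mem_toZFSet_iff.1 hx
    obtain ⟨g, hg, hgp, hcov⟩ := exists_covers hmin ξ hξ
    have hgP : ZFSet.pair ξ.toZFSet g ∈ P := by
      rw [hPdef, ZFSet.mem_sep, ZFSet.pair_mem_prod, mem_powersetIn]
      exact ⟨⟨hx, hgp, hg⟩, _, hx, g, hg, rfl, hcov⟩
    obtain ⟨q, ⟨hq, ξ', hξ', g', hg', h', hh', h1, rfl⟩, -⟩ := hcuniq _ hgP
    obtain ⟨rfl, rfl⟩ := ZFSet.pair_inj.1 h1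
    exact ⟨h', hh', hq⟩
  · obtain ⟨hξ, hgN, -⟩ := hcm _ _ hg
    obtain ⟨-, hhN, -⟩ := hcm _ _ hh
    have := (hcuniq _ (hcP hg)).unique ⟨hg, ξ, hξ, g, hgN, g, hgN, rfl, rfl⟩
      ⟨hh, ξ, hξ, g, hgN, h, hhN, rfl, rfl⟩
    exact (ZFSet.pair_inj.1 this).2

/-- The usual proof that infinite successor cardinals are regular, carried out in the model: a
cofinal map from a smaller ordinal into `t`, together with chosen maps from `γ` onto the ordinals
below `t`, would map `γ × γ`, hence `γ`, onto `t`. -/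
theorem regularInClass_of_succ {γ : Cardinal.{u}} (hγ : Cardinal.aleph0 ≤ γ) {t : Ordinal.{u}}
    (ht : IsCardinalIn (memOn N) ⟨t.toZFSet, hN.ordinal_mem t⟩) (hγt : γ.ord < t)
    (hmin : ∀ ξ, γ.ord < ξ → ξ < t →
      ¬ IsCardinalIn (memOn N) ⟨ξ.toZFSet, hN.ordinal_mem ξ⟩) :
    RegularInClass N t := by
  have hmem : ∀ {x y : Ordinal.{u}}, x.toZFSet ∈ y.toZFSet ↔ x < y :=
    Ordinal.toZFSet_mem_toZFSet_iff
  have hωγ : Ordinal.omega0 ≤ γ.ord := by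
    rw [← Cardinal.ord_aleph0]
    exact Cardinal.ord_le_ord.2 hγ
  have hlim := isSuccLimit_of_isCardinalIn ht (hωγ.trans_lt hγt)
  refine ⟨hN.ordinal_mem t, ⟨ht, ⟨⟨_, hN.ordinal_mem 0⟩, hmem.2 hlim.bot_lt⟩, ?_⟩, ?_⟩
  · rintro ⟨x, hxN⟩ hx
    obtain ⟨α, hα, rfl⟩ := Ordinal.mem_toZFSet_iff.1 (show x ∈ t.toZFSet from hx)
    exact ⟨⟨_, hN.ordinal_mem (Order.succ α)⟩, hmem.2 (hlim.succ_lt hα),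
      hmem.2 (Order.lt_succ α)⟩
  rintro ⟨a, haN⟩ ha ⟨⟨f, hf⟩, ⟨hfrel, hftot⟩, hfcof⟩
  obtain ⟨α, hα, rfl⟩ := Ordinal.mem_toZFSet_iff.1 (show a ∈ t.toZFSet from ha)
  obtain ⟨e, he, hetot, heinj⟩ := exists_pairing (N := N) hγ
  obtain ⟨g, hg, -, hgfun, hgcov⟩ := exists_covers hmin α hα
  obtain ⟨c, hc, hctot, hccov, hcfun⟩ := exists_covering_family hmin
  have : Fact (e ∈ N) := ⟨he⟩
  have : Fact (f ∈ N) := ⟨hf⟩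
  have : Fact (g ∈ N) := ⟨hg⟩
  have : Fact (c ∈ N) := ⟨hc⟩
  have htN : ∀ w ∈ t.toZFSet, w ∈ N := fun w => hN.transitive _ (hN.ordinal_mem _) w
  have hαt := Ordinal.toZFSet_monotone hα.le
  obtain ⟨η, hη, hno⟩ := not_covered_of_isCardinalIn ht hγt
    (fun x y => ∃ i ∈ γ.ord.toZFSet, ∃ j ∈ γ.ord.toZFSet, ZFSet.pair (ZFSet.pair i j) x ∈ e ∧
      ∃ z ∈ α.toZFSet, ZFSet.pair i z ∈ g ∧ ∃ ξ ∈ t.toZFSet, ZFSet.pair z ξ ∈ f ∧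
      ∃ h ∈ N, ZFSet.pair ξ h ∈ c ∧ ZFSet.pair j y ∈ h) (by
    rintro x hx y hy y' hy' ⟨i, hi, j, hj, hij, z, hz, hiz, ξ, hξ, hzξ, h, -, hξh, hjy⟩
      ⟨i', hi', j', hj', hij', z', hz', hiz', ξ', hξ', hzξ', h', -, hξh', hjy'⟩
    obtain ⟨rfl, rfl⟩ := ZFSet.pair_inj.1 (heinj _ _ _ hij hij')
    obtain rfl := hgfun i hi z (hαt hz) z' (hαt hz') hiz hiz'
    have hξξ' := (hftot ⟨z, hN.transitive _ haN _ hz⟩ hz).unique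
      (y₁ := ⟨ξ, htN ξ hξ⟩) (y₂ := ⟨ξ', htN ξ' hξ'⟩) (mapsTo_iff.2 hzξ) (mapsTo_iff.2 hzξ')
    obtain rfl : ξ = ξ' := congrArg Subtype.val hξξ'
    obtain rfl := hcfun _ _ _ hξh hξh'
    exact (hccov _ _ hξh).1 j hj y hy y' hy' hjy hjy')
  obtain ⟨⟨z, hzN⟩, ⟨ξ, hξN⟩, hz, hzξ, hle⟩ :=
    hfcof ⟨_, hN.ordinal_mem (Order.succ η)⟩ (hmem.2 (hlim.succ_lt hη))
  have hξt : ξ ∈ t.toZFSet := by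
    obtain ⟨p, hp, hpz⟩ := hzξ
    obtain ⟨x, y, -, hy, hpxy⟩ := hfrel p hp
    have := (isOrderedPair_iff.1 hpz).symm.trans (isOrderedPair_iff.1 hpxy)
    have hξy : ξ = y := (ZFSet.pair_inj.1 this).2
    exact hξy ▸ hy
  have hηξ : η.toZFSet ∈ ξ := by
    obtain ⟨ζ, -, rfl⟩ := Ordinal.mem_toZFSet_iff.1 hξt
    rcases hle with h | h
    · rw [← show (Order.succ η).toZFSet = ζ.toZFSet from congrArg Subtype.val h]
      exact hmem.2 (Order.lt_succ η)
    · exact hmem.2 ((Order.lt_succ η).trans (hmem.1 h))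
  obtain ⟨i, hi, hiz⟩ := hgcov z hz
  obtain ⟨h, hhN, hξh⟩ := hctot ξ hξt
  obtain ⟨j, hj, hjη⟩ := (hccov _ _ hξh).2 _ hηξ
  obtain ⟨x, hx, hijx⟩ := hetot i hi j hj
  exact hno x hx ⟨i, hi, j, hj, hijx, z, hz, hiz, ξ, hξt, mapsTo_iff.1 hzξ, h, hhN, hξh, hjη⟩

/-! ### Singular cardinals and their successors -/

/-- A singular cardinal of `V` above `δ` is singular in a weak extender model, which computes its
successor correctly. -/
theorem singular_and_succ {δ γ : Cardinal.{u}} (hM : IsWeakExtenderModel N δ) (hδ : δ < γ)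
    (hγ : γ.IsSingular) :
    SingularInClass N γ.ord ∧ SuccInClass N γ.ord (Order.succ γ).ord := by
  have hmem : ∀ {x y : Ordinal.{u}}, x.toZFSet ∈ y.toZFSet ↔ x < y :=
    Ordinal.toZFSet_mem_toZFSet_iff
  have hδ' : δ.ord < γ.ord := Cardinal.ord_lt_ord.2 hδ
  have hsucc : γ.ord < (Order.succ γ).ord := Cardinal.ord_lt_ord.2 (Order.lt_succ γ)
  constructor
  · refine ⟨hN.ordinal_mem _, isInfiniteCardinalIn_ord hγ.aleph0_le, ?_⟩
    by_contra! hcon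
    have hreg : RegularInClass N γ.ord := ⟨hN.ordinal_mem _, isInfiniteCardinalIn_ord hγ.aleph0_le,
      fun a ha ⟨f, hf⟩ => hcon a ha f hf⟩
    have := card_eq_cof_of_regularInClass hM hδ' hreg
    rw [Cardinal.card_ord] at this
    exact hγ.cof_ord_ne this.symm
  · refine ⟨hN.ordinal_mem _, hN.ordinal_mem _,
      (isInfiniteCardinalIn_ord (hγ.aleph0_le.trans (Order.le_succ γ))).1, hmem.2 hsucc, ?_⟩
    rintro ⟨s, hsN⟩ hs hγs
    obtain ⟨σ, rfl⟩ := ZFSet.isOrdinal_iff_mem_range_toZFSet.1 (isOrdinalIn_iff.1 hs.1)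
    have hγσ : γ.ord < σ := hmem.1 hγs
    by_contra hcon
    have hσ : σ < (Order.succ γ).ord := by
      by_contra! h
      rcases h.eq_or_lt with h | h
      · exact hcon (.inl (Subtype.ext (congrArg Ordinal.toZFSet h)))
      · exact hcon (.inr (hmem.2 h))
    obtain ⟨t, ⟨hγt, ht⟩, hmin⟩ := wellFounded_lt.has_min
      {t : Ordinal.{u} | γ.ord < t ∧ IsCardinalIn (memOn N) ⟨t.toZFSet, hN.ordinal_mem t⟩}
      ⟨σ, hγσ, hs⟩
    have htσ : t ≤ σ := not_lt.1 (hmin σ ⟨hγσ, hs⟩)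
    have hreg := regularInClass_of_succ hγ.aleph0_le ht hγt
      fun ξ h1 h2 h3 => hmin ξ ⟨h1, h3⟩ h2
    -- `t` has cardinality `γ`, so `γ` would be the cofinality of `t`, a regular cardinal
    have hcof := card_eq_cof_of_regularInClass hM (hδ'.trans hγt) hreg
    have hcard : t.card = γ := by
      apply le_antisymm
      · exact Order.lt_succ_iff.1 (Cardinal.lt_ord.1 (htσ.trans_lt hσ))
      · exact Cardinal.ord_le.1 hγt.le
    apply hγ.cof_ord_ne
    rw [← hcard, hcof, Ordinal.cof_ord_cof]

end Successor

end WeakExtender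

theorem mainTheorem6 (N : Set ZFSet.{u}) (δ : Cardinal.{u})
    (hN : WeakExtender.IsWeakExtenderModel N δ) :
    (∀ γ : Ordinal.{u}, δ.ord < γ → WeakExtender.RegularInClass N γ → γ.card = γ.cof) ∧
    (∀ γ : Cardinal.{u}, δ < γ → γ.IsSingular →
      WeakExtender.SingularInClass N γ.ord ∧
      WeakExtender.SuccInClass N γ.ord (Order.succ γ).ord) := by
  have := hN.isInnerModel
  exact ⟨fun γ hγ hreg => WeakExtender.card_eq_cof_of_regularInClass hN hγ hreg,
    fun γ hγ hsing => WeakExtender.singular_and_succ hN hγ hsing⟩
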